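/- Fix an optimal machine $U$ and a computable bijection between pairs of binary strings and binary strings, and let $C(x|y)$ be the Kolmogorov complexity (the length of a shortest $U$-program that prints $x$ given $y$), $C(x)=C(x|\Lambda)$ with $\Lambda$ the empty string, $C(x,y)$ the complexity of the code of the pair, and $I(x:y)=C(x)+C(y)-C(x,y)$. Let $\theta\in(0,\frac12)$ be such that $h(\theta)=\frac12$, where $h(t)=-t\log_2 t-(1-t)\log_2(1-t)$. Protocols. Alice gets $x\in\{0,1\}^n$ and private random bits $r_A\in\{0,1\}^{m(n)}$, Bob gets $y\in\{0,1\}^n$ and private random bits $r_B\in\{0,1\}^{m(n)}$, where $r_A,r_B$ are independent and uniform, and both get the auxiliary input $(C(x),C(y),C(x,y))$. They exchange bits according to a protocol $\pi$ which is uniformly computable (the number $m(n)$, the order of speaking, the messages and the final answers are computed by algorithms that are the same for all input lengths) and which terminates for all inputs, auxiliary inputs and random bits. The transcript $t$ is the sequence of all bits sent. The communication complexity of $\pi$ on inputs of length $n$ is the maximum of $|t|$ over all $x,y\in\{0,1\}^n$ (with their true auxiliary input) and all $r_A,r_B$. The parties agree on a secret key of size $\ge s$, with secrecy tolerance $K\log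 n$, if their final answers are the same string $z$, $|z|\ge s$ and $C(z|t)\ge|z|-K\log n$. Theorem. There is a constant $c>0$ such that for every choice of $U$ and of the coding of pairs there is $D_0$ such that the following holds for all $D\ge D_0$. For every $\delta\in(0,1)$, every $K$ and every randomized protocol $\pi$ there is $N$ such that, for every $n\ge N$ and every $d$ equal to $\theta n$ rounded up or down to an integer: if for all pairs of strings $x,y\in\{0,1\}^n$ at Hamming distance $d$ such that each of $I(x:y)$, $C(x|y)$, $C(y|x)$ differs from $0.5n$ by at most $D\log n$, Alice and Bob agree with probability $>0.99$ on a secret key of size $\ge\delta n$ with secrecy tolerance $K\log n$, then the communication complexity of $\pi$ on inputs of length $n$ is at least $c\,\delta n$. -/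

import Mathlib

/-! ### Kolmogorov complexity -/

namespace SecretKey

/-- A description method (interpreter): the partial function computed by a machine that gets a
program `p` and a condition `y` and, if it halts, prints a string. -/
abbrev Machine : Type := List Bool × List Bool →. List Bool

/-- `C_M(x | y)`: the length of a shortest program that prints `x` on the condition `y`. -/
noncomputable def condComplexity (M : Machine) (x y : List Bool) : ℕ :=
  sInf {k : ℕ | ∃ p : List Bool, x ∈ M (p, y) ∧ p.length = k}

/-- `U` is an optimal machine: it is computable, and for every computable machine `M` there is a
constant `c` with `C_U(x | y) ≤ C_M(x | y) + c` for all `x`, `y` (where `C_M(x | y)` is infinite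
if no program prints `x` on `y`). -/
def IsOptimal (U : Machine) : Prop :=
  Partrec U ∧ ∀ M : Machine, Partrec M → ∃ c : ℕ, ∀ x y p : List Bool, x ∈ M (p, y) →
    ∃ q : List Bool, x ∈ U (q, y) ∧ q.length ≤ p.length + c

/-- `C(x) = C(x | Λ)`, where `Λ` is the empty string. -/
noncomputable def complexity (U : Machine) (x : List Bool) : ℕ :=
  condComplexity U x []

/-- `C(x, y)`: the complexity of the code of the pair, for a coding `e` of pairs by strings. -/
noncomputable def pairComplexity (U : Machine) (e : List Bool × List Bool ≃ List Bool)
    (x y : List Bool) : ℕ :=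
  complexity U (e (x, y))

/-- `I(x : y) = C(x) + C(y) - C(x, y)`. -/
noncomputable def mutualInfo (U : Machine) (e : List Bool × List Bool ≃ List Bool)
    (x y : List Bool) : ℤ :=
  (complexity U x : ℤ) + (complexity U y : ℤ) - (pairComplexity U e x y : ℤ)

/-! ### The inputs -/

/-- A pair of `n`-bit strings at Hamming distance `d` such that `I(x : y)`, `C(x | y)` and
`C(y | x)` are equal to `n / 2` with a precision of `D log n`. -/
structure IsHammingPair (U : Machine) (e : List Bool × List Bool ≃ List Bool) (D : ℝ)
    (d n : ℕ) (x y : Fin n → Bool) : Prop where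
  dist_eq : hammingDist x y = d
  mutualInfo_near : |(mutualInfo U e (List.ofFn x) (List.ofFn y) : ℝ) - n / 2| ≤ D * Real.log n
  cond_left_near : |(condComplexity U (List.ofFn x) (List.ofFn y) : ℝ) - n / 2| ≤ D * Real.log n
  cond_right_near : |(condComplexity U (List.ofFn y) (List.ofFn x) : ℝ) - n / 2| ≤ D * Real.log n

/-! ### Communication protocols with private randomness -/

/-- Values for `C(x)`, `C(y)`, `C(x, y)`, given to both parties as an auxiliary input. -/
abbrev Profile : Type := ℕ × ℕ × ℕ

/-- The complexity profile of a pair of strings. -/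
noncomputable def profile (U : Machine) (e : List Bool × List Bool ≃ List Bool)
    (x y : List Bool) : Profile :=
  (complexity U x, complexity U y, pairComplexity U e x y)

/-- The rules of a uniformly computable two-party protocol: the same algorithms serve inputs of
all lengths. -/
structure Rules where
  /-- the number of private random bits of each party on inputs of length `n` -/
  randLen : ℕ → ℕ
  /-- given the input length, the auxiliary input and the bits sent so far: `none` if the
  communication is over, `some false` if Alice sends the next bit, `some true` if Bob does -/
  turn : ℕ × Profile × List Bool → Option Bool
  /-- the bit sent by Alice, computed from the auxiliary input, her input, her random bits and the
  bits sent so far -/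
  alice : Profile × List Bool × List Bool × List Bool → Bool
  /-- the bit sent by Bob -/
  bob : Profile × List Bool × List Bool × List Bool → Bool
  /-- the final answer of Alice, computed from the auxiliary input, her input, her random bits and
  the complete transcript -/
  outAlice : Profile × List Bool × List Bool × List Bool → List Bool
  /-- the final answer of Bob -/
  outBob : Profile × List Bool × List Bool × List Bool → List Bool
  computable_randLen : Computable randLen
  computable_turn : Computable turn
  computable_alice : Computable alice
  computable_bob : Computable bob
  computable_outAlice : Computable outAlice
  computable_outBob : Computable outBob

namespace Rules

variable (π : Rules) {n : ℕ} (a : Profile) (x y : Fin n → Bool)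
  (rA rB : Fin (π.randLen n) → Bool)

/-- One step of the communication; `t` is the list of bits sent so far, in the order of
sending. -/
def step (t : List Bool) : List Bool :=
  match π.turn (n, a, t) with
  | none => t
  | some false => t ++ [π.alice (a, List.ofFn x, List.ofFn rA, t)]
  | some true => t ++ [π.bob (a, List.ofFn y, List.ofFn rB, t)]

/-- The bits sent in the first `k` steps. -/
def run (k : ℕ) : List Bool :=
  (π.step a x y rA rB)^[k] []

end Rules

/-- A protocol: for all inputs and all values of the random bits the communication comes to an
end. -/
structure Protocol extends Rules where
  halts : ∀ (n : ℕ) (a : Profile) (x y : Fin n → Bool) (rA rB : Fin (randLen n) → Bool),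
    ∃ k : ℕ, turn (n, a, toRules.run a x y rA rB k) = none

namespace Protocol

variable (π : Protocol) {n : ℕ}

/-- The transcript: all the bits sent until the communication is over. -/
def transcript (a : Profile) (x y : Fin n → Bool) (rA rB : Fin (π.randLen n) → Bool) :
    List Bool :=
  π.run a x y rA rB (Nat.find (π.halts n a x y rA rB))

/-- The final answer of Alice. -/
def keyAlice (a : Profile) (x y : Fin n → Bool) (rA rB : Fin (π.randLen n) → Bool) :
    List Bool :=
  π.outAlice (a, List.ofFn x, List.ofFn rA, π.transcript a x y rA rB)

/-- The final answer of Bob. -/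
def keyBob (a : Profile) (x y : Fin n → Bool) (rA rB : Fin (π.randLen n) → Bool) :
    List Bool :=
  π.outBob (a, List.ofFn y, List.ofFn rB, π.transcript a x y rA rB)

variable (U : Machine) (e : List Bool × List Bool ≃ List Bool)

/-- On inputs `x`, `y` (and their complexity profile) and random bits `rA`, `rB` the parties agree
on a secret key of size at least `s`: their answers are one and the same string `z` with
`|z| ≥ s`, and `C(z | t) ≥ |z| - K log n` for the transcript `t`. -/
def Agree (K s : ℝ) (x y : Fin n → Bool) (r : (Fin (π.randLen n) → Bool) × (Fin (π.randLen n) → Bool)) :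
    Prop :=
  let a := profile U e (List.ofFn x) (List.ofFn y)
  let t := π.transcript a x y r.1 r.2
  let z := π.keyAlice a x y r.1 r.2
  z = π.keyBob a x y r.1 r.2 ∧ s ≤ (z.length : ℝ) ∧
    (z.length : ℝ) - K * Real.log n ≤ (condComplexity U z t : ℝ)

/-- The probability of agreement on a secret key of size at least `s`, where the private random
strings of the two parties are uniformly distributed and independent. -/
noncomputable def agreeProb (K s : ℝ) (x y : Fin n → Bool) : ℝ :=
  (Nat.card {r : (Fin (π.randLen n) → Bool) × (Fin (π.randLen n) → Bool) //
      π.Agree U e K s x y r} : ℝ) /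
    (Nat.card ((Fin (π.randLen n) → Bool) × (Fin (π.randLen n) → Bool)) : ℝ)

/-- The communication complexity on inputs of length `n`: the maximal length of the transcript
over all pairs of `n`-bit inputs and all values of the random bits. -/
noncomputable def commComplexity (n : ℕ) : ℕ :=
  (Finset.univ : Finset ((Fin n → Bool) × (Fin n → Bool) ×
      (Fin (π.randLen n) → Bool) × (Fin (π.randLen n) → Bool))).sup fun v =>
    (π.transcript (profile U e (List.ofFn v.1) (List.ofFn v.2.1))
      v.1 v.2.1 v.2.2.1 v.2.2.2).length

end Protocol

end SecretKey

namespace SecretKey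

/-! ### Upper and lower bounds on Kolmogorov complexity -/

/-! Suppose that the parties agree on `z` after the transcript `t`, with auxiliary input `a`. If
Alice, on a uniform input and uniform random bits, answered `z` to `(a, t)` with probability at
least `2 ^ (-s)`, then `z` would be one of at most `2 ^ s` such answers. These can be enumerated
from `t`, `a`, `n` and `s`, so `C(z | t) ≤ s + O(log n)`. The same holds for Bob. Secrecy therefore
forces a key of size `δn` to be a light answer for both parties, of probability at most `2 ^ (-s)`
with `s = δn - O(log n)` (`IsOptimal.answerCount_le_of_agree`).

Now treat `(a, t)` as a fixed hint, so that each answer depends on the party's own input and random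
bits only. For one answer `z` let `f` and `g` be the probabilities that Alice on `x` and Bob on `y`
give it. Hypercontractivity (`noise_form_le`) bounds the correlation of `f` and `g` across noise of
rate `θ` by `τ ^ γ` times the average of their means, where `τ = 2 ^ (-s)` bounds the means and `γ =
θ / (1 - θ)`. The means sum to at most one over all `z`, hence agreement on a light answer has
probability at most `τ ^ γ`. Passing from noise to the sphere of radius `d ≈ θn` costs only a
polynomial factor (`exp_neg_le_choose_mul_noiseWeight`).

The choice `h(θ) = 1/2` makes at least half of the pairs at distance `d` have the required
complexity profile (`IsOptimal.exists_half_isHammingPair`), so the event of agreement has constant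
weight among pairs at distance `d`. A union bound over the hints, polynomially many profiles and
fewer than `2 ^ (ℓ + 1)` transcripts of length at most `ℓ`, gives `1 / poly(n) ≤ poly(n) * 2 ^ (ℓ -
γs)`, that is `ℓ ≥ γδn - O(log n)`. -/

/-- The positive integer with the binary expansion `1u`. -/
def bitsVal (u : List Bool) : ℕ := u.foldl (fun s b => 2 * s + b.toNat) 1

lemma bitsVal_concat (u : List Bool) (b : Bool) : bitsVal (u ++ [b]) = 2 * bitsVal u + b.toNat := by
  simp [bitsVal]

lemma exists_bitsVal_eq (N : ℕ) (hN : 0 < N) : ∃ u, bitsVal u = N ∧ 2 ^ u.length ≤ N := by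
  induction N using Nat.strong_induction_on with
  | _ N ih =>
    rcases Nat.lt_or_ge N 2 with h | h
    · exact ⟨[], by simp [bitsVal]; omega, by simp; omega⟩
    · obtain ⟨u, hu, hl⟩ := ih (N / 2) (by omega) (by omega)
      refine ⟨u ++ [decide (N % 2 = 1)], ?_, ?_⟩
      · rw [bitsVal_concat, hu]
        rcases Nat.mod_two_eq_zero_or_one N with h0 | h0 <;> simp [h0] <;> omega
      · rw [List.length_append, List.length_singleton, pow_succ]
        omega

lemma primrec_bitsVal : Primrec bitsVal := by
  refine Primrec.list_foldl (h := fun (_ : List Bool) (q : ℕ × Bool) => 2 * q.1 + q.2.toNat)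
    Primrec.id (Primrec.const 1) ?_
  refine Primrec.nat_add.comp (Primrec.nat_mul.comp (Primrec.const 2)
    (Primrec.fst.comp Primrec.snd)) ?_
  exact (Primrec.dom_finite Bool.toNat).comp (Primrec.snd.comp Primrec.snd)

/-- The length of the header of a program: the number of leading ones. -/
def headerLen (p : List Bool) : ℕ := (p.takeWhile id).length

lemma primrec_headerLen : Primrec headerLen :=
  Primrec.list_length.comp (Primrec.list_takeWhile Primrec.id)

/-- The numerical parameter encoded in the header of a program. -/
def programParam (p : List Bool) : ℕ :=
  -- The leading one in `bitsVal` makes every string a positive number, so the shift by one makes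
  -- all of `ℕ` available.
  bitsVal ((p.drop (headerLen p + 1)).take (headerLen p)) - 1

/-- The index encoded in a program after the header. -/
def programIndex (p : List Bool) : ℕ :=
  bitsVal ((p.drop (headerLen p + 1)).drop (headerLen p)) - 1

lemma primrec_programParam : Primrec programParam :=
  Primrec.pred.comp (primrec_bitsVal.comp (Primrec.list_take.comp primrec_headerLen
    (Primrec.list_drop.comp (Primrec.succ.comp primrec_headerLen) Primrec.id)))

lemma primrec_programIndex : Primrec programIndex :=
  Primrec.pred.comp (primrec_bitsVal.comp (Primrec.list_drop.comp primrec_headerLen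
    (Primrec.list_drop.comp (Primrec.succ.comp primrec_headerLen) Primrec.id)))

/-- The program is `1^|u| 0 u v` with `u` for the parameter and `v` for the index. The
self-delimiting header doubles the cost of the parameter, while the index is charged only once. -/
lemma exists_program (P I l k : ℕ) (hP : P < 2 ^ l) (hI : I < 2 ^ k) :
    ∃ p, programParam p = P ∧ programIndex p = I ∧ p.length ≤ 2 * l + k + 1 := by
  obtain ⟨u, hu, hul⟩ := exists_bitsVal_eq (P + 1) (by omega)
  obtain ⟨v, hv, hvl⟩ := exists_bitsVal_eq (I + 1) (by omega)
  have hul' : u.length ≤ l := by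
    refine (Nat.pow_le_pow_iff_right (by norm_num : 1 < 2)).1 (hul.trans hP)
  have hvl' : v.length ≤ k := by
    refine (Nat.pow_le_pow_iff_right (by norm_num : 1 < 2)).1 (hvl.trans hI)
  have hh : headerLen (List.replicate u.length true ++ (false :: (u ++ v))) = u.length := by
    simp [headerLen]
  have hd : (List.replicate u.length true ++ (false :: (u ++ v))).drop (u.length + 1) = u ++ v := by
    rw [List.drop_append]
    simp
  refine ⟨List.replicate u.length true ++ (false :: (u ++ v)), ?_, ?_, ?_⟩
  · rw [programParam, hh, hd]
    simp [hu]
  · rw [programIndex, hh, hd]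
    simp [hv]
  · simp
    omega

variable {U : Machine} {σ : Type*} [Primcodable σ]

lemma condComplexity_le {x y p : List Bool} (h : x ∈ U (p, y)) : condComplexity U x y ≤ p.length :=
  Nat.sInf_le ⟨p, h, rfl⟩

/-- Compared with the machine that prints its own program, an optimal machine can print every
string. So the infimum in `condComplexity` is attained and is never the default value of an empty
set. -/
lemma IsOptimal.exists_program (hU : IsOptimal U) (x y : List Bool) :
    ∃ p, x ∈ U (p, y) ∧ p.length = condComplexity U x y := by
  obtain ⟨c, hc⟩ := hU.2 (fun a => Part.some a.1) Computable.fst.partrec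
  obtain ⟨q, hq, -⟩ := hc x y x (Part.mem_some _)
  exact Nat.sInf_mem (s := {k : ℕ | ∃ p : List Bool, x ∈ U (p, y) ∧ p.length = k}) ⟨_, q, hq, rfl⟩

lemma IsOptimal.condComplexity_le_length (hU : IsOptimal U) :
    ∃ c : ℕ, ∀ x y, condComplexity U x y ≤ x.length + c := by
  obtain ⟨c, hc⟩ := hU.2 (fun a => Part.some a.1) Computable.fst.partrec
  refine ⟨c, fun x y => ?_⟩
  obtain ⟨q, hq, hl⟩ := hc x y x (Part.mem_some _)
  exact (condComplexity_le hq).trans hl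

/-- A string that is computed from a parameter, an index and a condition has complexity at most
the length of the index and twice the length of the parameter. -/
lemma IsOptimal.condComplexity_le_of_partrec (hU : IsOptimal U)
    {F : σ × ℕ × List Bool →. List Bool} (hF : Partrec F) :
    ∃ c : ℕ, ∀ (s : σ) (I : ℕ) (y z : List Bool) (l k : ℕ), z ∈ F (s, I, y) →
      Encodable.encode s < 2 ^ l → I < 2 ^ k → condComplexity U z y ≤ 2 * l + k + c := by
  let M : Machine := fun a => ((Encodable.decode (α := σ) (programParam a.1) : Option σ) :
    Part σ).bind fun s => F (s, programIndex a.1, a.2)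
  have hM : Partrec M := by
    refine Partrec.bind (Computable.ofOption (Computable.decode.comp
      (primrec_programParam.to_comp.comp Computable.fst))) ?_
    exact hF.comp (Computable.snd.pair ((primrec_programIndex.to_comp.comp
      (Computable.fst.comp Computable.fst)).pair (Computable.snd.comp Computable.fst)))
  obtain ⟨c, hc⟩ := hU.2 M hM
  refine ⟨c + 1, fun s I y z l k hz hs hI => ?_⟩
  obtain ⟨p, hp1, hp2, hp3⟩ := SecretKey.exists_program _ I l k hs hI
  obtain ⟨q, hq, hl⟩ := hc z y p (by
    simp only [M, hp1, hp2, Encodable.encodek, Part.coe_some, Part.bind_some]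
    exact hz)
  have := condComplexity_le hq
  omega

/-! ### Describing an element of a decidable finite set by its rank. -/

/-- The number of `j < b` with `f j`. -/
def countBelow (f : ℕ → Bool) (b : ℕ) : ℕ := Nat.rec 0 (fun j s => s + (f j).toNat) b

lemma countBelow_eq (f : ℕ → Bool) (b : ℕ) :
    countBelow f b = ((Finset.range b).filter fun j => f j = true).card := by
  induction b with
  | zero => rfl
  | succ b ih =>
    change countBelow f b + (f b).toNat = _
    rw [ih, Finset.range_add_one, Finset.filter_insert]
    cases h : f b <;> simp

lemma computable_countBelow {α : Type*} [Primcodable α] {f : α → ℕ → Bool} {b : α → ℕ}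
    (hf : Computable₂ f) (hb : Computable b) : Computable fun a => countBelow (f a) (b a) := by
  refine Computable.nat_rec (h := fun a (q : ℕ × ℕ) => q.2 + (f a q.1).toNat) hb
    (Computable.const 0) ?_
  refine Primrec.nat_add.to_comp.comp (Computable.snd.comp Computable.snd) ?_
  exact (Primrec.dom_finite Bool.toNat).to_comp.comp
    (hf.comp Computable.fst (Computable.fst.comp Computable.snd))

attribute [irreducible] countBelow

/-- An element of a decidable finite set is described by its number in the set. -/
lemma IsOptimal.condComplexity_le_of_card (hU : IsOptimal U)
    {R : σ × List Bool × List Bool → Bool} (hR : Computable R) :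
    ∃ c : ℕ, ∀ (s : σ) (y z : List Bool) (S : Finset (List Bool)) (l k : ℕ), R (s, y, z) = true →
      (∀ w, R (s, y, w) = true → w ∈ S) → Encodable.encode s < 2 ^ l → S.card ≤ 2 ^ k →
      condComplexity U z y ≤ 2 * l + k + c := by
  -- Membership transported to codes; comparing `j` with the code of `w` leaves exactly one `j` for
  -- each element.
  let T : σ × List Bool → ℕ → Bool := fun a j =>
    ((Encodable.decode (α := List Bool) j).map fun w =>
      R (a.1, a.2, w) && decide (Encodable.encode w = j)).getD false
  have hTiff : ∀ a j, T a j = true ↔ ∃ w, R (a.1, a.2, w) = true ∧ Encodable.encode w = j := by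
    intro a j
    constructor
    · intro h
      cases hd : Encodable.decode (α := List Bool) j with
      | none => simp [T, hd] at h
      | some w => exact ⟨w, by simpa [T, hd] using h⟩
    · rintro ⟨w, hw, rfl⟩
      simp [T, hw]
  have hT : Computable₂ T := by
    refine Computable.option_getD (Computable.option_map (Computable.decode.comp Computable.snd) ?_)
      (Computable.const false)
    refine (Primrec.and.to_comp).comp (hR.comp ?_) ((Primrec.beq (α := ℕ)).to_comp.comp
      (Computable.encode.comp Computable.snd) (Computable.snd.comp Computable.fst))
    exact ((Computable.fst.comp (Computable.fst.comp Computable.fst)).pair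
      ((Computable.snd.comp (Computable.fst.comp Computable.fst)).pair Computable.snd))
  -- The search looks for a member with exactly as many smaller members as the given index.
  let G : σ × ℕ × List Bool → ℕ → Bool := fun a j =>
    T (a.1, a.2.2) j && decide (countBelow (T (a.1, a.2.2)) j = a.2.1)
  have hG : Computable₂ G := by
    have h1 : Computable fun q : (σ × ℕ × List Bool) × ℕ => (q.1.1, q.1.2.2) :=
      (Computable.fst.comp Computable.fst).pair
        (Computable.snd.comp (Computable.snd.comp Computable.fst))
    refine (Primrec.and.to_comp).comp (hT.comp h1 Computable.snd) ?_
    have h2 : Computable fun q : (σ × ℕ × List Bool) × ℕ =>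
        countBelow (T (q.1.1, q.1.2.2)) q.2 :=
      computable_countBelow (f := fun q : (σ × ℕ × List Bool) × ℕ => T (q.1.1, q.1.2.2))
        (hT.comp (h1.comp Computable.fst) Computable.snd) Computable.snd
    exact (Primrec.beq (α := ℕ)).to_comp.comp h2
      (Computable.fst.comp (Computable.snd.comp Computable.fst))
  let F : σ × ℕ × List Bool →. List Bool := fun a =>
    (Nat.rfind fun j => Part.some (G a j)).map fun j =>
      (Encodable.decode (α := List Bool) j).getD []
  have hF : Partrec F := by
    refine Partrec.map (Partrec.rfind (hG.partrec₂)) ?_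
    exact Computable.option_getD (Computable.decode.comp Computable.snd) (Computable.const [])
  obtain ⟨c, hc⟩ := hU.condComplexity_le_of_partrec hF
  refine ⟨c, fun s y z S l k hz hS hs hk => ?_⟩
  set j := Encodable.encode z with hj
  have hzj : (Encodable.decode (α := List Bool) j).getD [] = z := by simp [hj]
  have hTj : T (s, y) j = true := (hTiff _ _).2 ⟨z, hz, rfl⟩
  refine hc s (countBelow (T (s, y)) j) y z l k ?_ hs ?_
  · refine (Part.mem_map_iff _).2 ⟨j, ?_, hzj⟩
    refine Nat.mem_rfind.2 ⟨?_, fun {i} hi => ?_⟩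
    · simp [G, hTj]
    · rw [Part.mem_some_iff, eq_comm]
      by_contra hcon
      simp only [Bool.not_eq_false, G, Bool.and_eq_true, decide_eq_true_eq] at hcon
      rw [countBelow_eq, countBelow_eq] at hcon
      -- An earlier member `i` has strictly smaller rank than `j`, so the search cannot stop before
      -- `j`.
      have hss : insert i ((Finset.range i).filter fun a => T (s, y) a = true) ⊆
          (Finset.range j).filter fun a => T (s, y) a = true := by
        intro a ha
        simp only [Finset.mem_insert, Finset.mem_filter, Finset.mem_range] at ha ⊢
        rcases ha with rfl | ha
        · exact ⟨hi, hcon.1⟩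
        · exact ⟨ha.1.trans hi, ha.2⟩
      have := Finset.card_le_card hss
      rw [Finset.card_insert_of_notMem (by simp), hcon.2] at this
      omega
  · refine lt_of_lt_of_le ?_ hk
    rw [countBelow_eq]
    -- The rank does not count `j` itself, which makes the bound by the size of the set strict.
    have hss : insert j ((Finset.range j).filter fun a => T (s, y) a = true) ⊆
        S.image Encodable.encode := by
      intro a ha
      have hTa : T (s, y) a = true := by
        rcases Finset.mem_insert.1 ha with rfl | ha
        · exact hTj
        · exact (Finset.mem_filter.1 ha).2
      obtain ⟨w, hw, rfl⟩ := (hTiff _ _).1 hTa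
      exact Finset.mem_image_of_mem _ (hS w hw)
    have h1 := (Finset.card_le_card hss).trans Finset.card_image_le
    rw [Finset.card_insert_of_notMem (by simp)] at h1
    omega

/-! ### Counting strings of small complexity. -/

/-- The set of strings of length less than `k`. -/
def shortStrings (k : ℕ) : Finset (List Bool) :=
  (Finset.range k).biUnion fun i => Finset.univ.image (List.ofFn : (Fin i → Bool) → List Bool)

lemma mem_shortStrings {k : ℕ} {p : List Bool} : p ∈ shortStrings k ↔ p.length < k := by
  simp only [shortStrings, Finset.mem_biUnion, Finset.mem_range, Finset.mem_image,
    Finset.mem_univ, true_and]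
  constructor
  · rintro ⟨i, hi, f, rfl⟩
    simpa using hi
  · intro h
    exact ⟨_, h, p.get, List.ofFn_get p⟩

lemma card_shortStrings_le (k : ℕ) : (shortStrings k).card ≤ 2 ^ k := by
  refine Finset.card_biUnion_le.trans ?_
  calc ∑ i ∈ Finset.range k, (Finset.univ.image (List.ofFn : (Fin i → Bool) → List Bool)).card
      ≤ ∑ i ∈ Finset.range k, 2 ^ i := by
        refine Finset.sum_le_sum fun i _ => Finset.card_image_le.trans ?_
        simp
    _ ≤ 2 ^ k := by
        rw [Nat.geomSum_eq (le_refl 2)]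
        simp

/-- There are at most `2 ^ k` strings of complexity less than `k`. -/
lemma IsOptimal.card_filter_le {α : Type*} [Fintype α] (hU : IsOptimal U) (g : α → List Bool)
    (hg : Function.Injective g) (y : List Bool) (k : ℕ) :
    (Finset.univ.filter fun a => condComplexity U (g a) y < k).card ≤ 2 ^ k := by
  choose p hp hpl using fun a => hU.exists_program (g a) y
  refine le_trans ?_ (card_shortStrings_le k)
  refine Finset.card_le_card_of_injOn p ?_ ?_
  · intro a ha
    simp only [Finset.coe_filter, Finset.mem_univ, true_and, Set.mem_ofPred_eq] at ha
    exact mem_shortStrings.2 (by rw [hpl]; exact ha)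
  · intro a _ b _ hab
    refine hg (Part.mem_unique (hp a) ?_)
    rw [show p a = p b from hab]
    exact hp b

/-! ### Hypercontractivity of the noise operator on the cube -/

/-- Both sides vanish at `s = 0`. The derivative of the difference is `q` times `(1 + u) ^ (q - 1) +
(1 - u) ^ (q - 1) - 2`. This is nonnegative because the two powers have product `(1 - u²) ^ (q - 1)
≥ 1`, hence sum at least `2`. -/
lemma one_add_rpow_sub_ge {q s : ℝ} (hq0 : 0 ≤ q) (hq1 : q ≤ 1) (hs0 : 0 ≤ s) (hs1 : s < 1) :
    2 * q * s ≤ (1 + s) ^ q - (1 - s) ^ q := by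
  let φ : ℝ → ℝ := fun s => (1 + s) ^ q - (1 - s) ^ q - 2 * q * s
  have hd : ∀ u ∈ Set.Ico (0 : ℝ) 1, HasDerivAt φ
      (1 * q * (1 + u) ^ (q - 1) - (-1) * q * (1 - u) ^ (q - 1) - 2 * q * 1) u := by
    intro u hu
    refine HasDerivAt.sub (HasDerivAt.sub ?_ ?_) ((hasDerivAt_id u).const_mul _)
    · exact ((hasDerivAt_id u).const_add 1).rpow_const (Or.inl (by have := hu.1; simp; linarith))
    · exact ((hasDerivAt_id u).const_sub 1).rpow_const (Or.inl (by have := hu.2; simp; linarith))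
  have hm : MonotoneOn φ (Set.Ico 0 1) := by
    refine monotoneOn_of_deriv_nonneg (convex_Ico 0 1)
      (fun u hu => (hd u hu).continuousAt.continuousWithinAt) ?_ ?_
    · intro u hu
      rw [interior_Ico] at hu
      exact (hd u ⟨hu.1.le, hu.2⟩).differentiableAt.differentiableWithinAt
    · intro u hu
      rw [interior_Ico] at hu
      rw [(hd u ⟨hu.1.le, hu.2⟩).deriv]
      have h1 : 0 < 1 + u := by linarith [hu.1]
      have h2 : 0 < 1 - u := by linarith [hu.2]
      have hA : 0 < (1 + u) ^ (q - 1) := Real.rpow_pos_of_pos h1 _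
      have hB : 0 < (1 - u) ^ (q - 1) := Real.rpow_pos_of_pos h2 _
      have hAB : 1 ≤ (1 + u) ^ (q - 1) * (1 - u) ^ (q - 1) := by
        rw [← Real.mul_rpow h1.le h2.le]
        refine Real.one_le_rpow_of_pos_of_le_one_of_nonpos (mul_pos h1 h2) ?_ (by linarith)
        nlinarith [sq_nonneg u]
      have h3 : 2 ≤ (1 + u) ^ (q - 1) + (1 - u) ^ (q - 1) := by
        nlinarith [sq_nonneg ((1 + u) ^ (q - 1) - (1 - u) ^ (q - 1))]
      nlinarith
  have := hm (Set.left_mem_Ico.2 zero_lt_one) ⟨hs0, hs1⟩ hs0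
  simp only [φ] at this
  norm_num at this
  linarith

/-- The integrated form of `one_add_rpow_sub_ge` with `q = p - 1`. -/
lemma two_add_sq_le_rpow_add_rpow {p s : ℝ} (hp1 : 1 ≤ p) (hp2 : p ≤ 2) (hs0 : 0 ≤ s)
    (hs1 : s ≤ 1) : 2 + p * (p - 1) * s ^ 2 ≤ (1 + s) ^ p + (1 - s) ^ p := by
  let φ : ℝ → ℝ := fun s => (1 + s) ^ p + (1 - s) ^ p - p * (p - 1) * s ^ 2
  have hd : ∀ u : ℝ, HasDerivAt φ
      (1 * p * (1 + u) ^ (p - 1) + (-1) * p * (1 - u) ^ (p - 1) - p * (p - 1) * (2 * u)) u := by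
    intro u
    refine HasDerivAt.sub (HasDerivAt.add ?_ ?_) ?_
    · exact ((hasDerivAt_id u).const_add 1).rpow_const (Or.inr hp1)
    · exact ((hasDerivAt_id u).const_sub 1).rpow_const (Or.inr hp1)
    · simpa using (hasDerivAt_pow 2 u).const_mul (p * (p - 1))
  have hm : MonotoneOn φ (Set.Icc 0 1) := by
    refine monotoneOn_of_deriv_nonneg (convex_Icc 0 1)
      (fun u _ => (hd u).continuousAt.continuousWithinAt)
      (fun u _ => (hd u).differentiableAt.differentiableWithinAt) ?_
    intro u hu
    rw [interior_Icc] at hu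
    rw [(hd u).deriv]
    have := one_add_rpow_sub_ge (q := p - 1) (by linarith) (by linarith) hu.1.le hu.2
    nlinarith
  have := hm (Set.left_mem_Icc.2 zero_le_one) ⟨hs0, hs1⟩ hs0
  simp only [φ] at this
  norm_num at this
  linarith

/-- Bernoulli's inequality for the concave power `p / 2 ≤ 1` reduces this to
`two_add_sq_le_rpow_add_rpow`. -/
lemma one_add_mul_sq_le {p ρ s : ℝ} (hp1 : 1 ≤ p) (hp2 : p ≤ 2) (hρ0 : 0 ≤ ρ) (hρ : ρ ≤ p - 1)
    (hs0 : 0 ≤ s) (hs1 : s ≤ 1) :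
    1 + ρ * s ^ 2 ≤ (((1 + s) ^ p + (1 - s) ^ p) / 2) ^ (2 / p) := by
  have h0 : 0 ≤ ρ * s ^ 2 := by positivity
  have h1 : (1 + ρ * s ^ 2) ^ (p / 2) ≤ ((1 + s) ^ p + (1 - s) ^ p) / 2 := by
    have hb := rpow_one_add_le_one_add_mul_self (s := ρ * s ^ 2) (p := p / 2) (by linarith)
      (by linarith) (by linarith)
    have := two_add_sq_le_rpow_add_rpow hp1 hp2 hs0 hs1
    have : p * ρ * s ^ 2 ≤ p * (p - 1) * s ^ 2 := by gcongr
    linarith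
  calc 1 + ρ * s ^ 2 = ((1 + ρ * s ^ 2) ^ (p / 2)) ^ (2 / p) := by
        rw [← Real.rpow_mul (by linarith)]
        field_simp
        simp
    _ ≤ _ := Real.rpow_le_rpow (by positivity) h1 (by positivity)

/-- The two-point inequality. -/
lemma two_point_quadratic {p ρ a b : ℝ} (hp1 : 1 ≤ p) (hp2 : p ≤ 2) (hρ0 : 0 ≤ ρ)
    (hρ : ρ ≤ p - 1) (ha : 0 ≤ a) (hb : 0 ≤ b) :
    (1 + ρ) / 4 * (a ^ 2 + b ^ 2) + (1 - ρ) / 2 * (a * b) ≤ ((a ^ p + b ^ p) / 2) ^ (2 / p) := by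
  wlog hab : b ≤ a generalizing a b
  · have := this hb ha (le_of_not_ge hab)
    rw [add_comm (a ^ p), add_comm (a ^ 2), mul_comm a b]
    exact this
  rcases (add_nonneg ha hb).eq_or_lt with h | h
  · have ha' : a = 0 := by linarith
    have hb' : b = 0 := by linarith
    subst ha' hb'
    simp
    positivity
  -- By homogeneity only the relative difference `s` matters: `a = m (1 + s)` and `b = m (1 - s)`
  -- turn the quadratic form into `m² (1 + ρ s²)`.
  set m := (a + b) / 2 with hm
  have hm0 : 0 < m := by positivity
  set s := (a - b) / (a + b) with hs
  have hs0 : 0 ≤ s := div_nonneg (by linarith) h.le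
  have hs1 : s ≤ 1 := (div_le_one h).2 (by linarith)
  have hA : a = m * (1 + s) := by rw [hm, hs]; field_simp; ring
  have hB : b = m * (1 - s) := by rw [hm, hs]; field_simp; ring
  have key := one_add_mul_sq_le hp1 hp2 hρ0 hρ hs0 hs1
  have hR : ((a ^ p + b ^ p) / 2) ^ (2 / p) =
      m ^ 2 * (((1 + s) ^ p + (1 - s) ^ p) / 2) ^ (2 / p) := by
    conv_lhs => rw [hA, hB]
    rw [Real.mul_rpow hm0.le (by linarith), Real.mul_rpow hm0.le (by linarith), ← mul_add,
      mul_div_assoc, Real.mul_rpow (by positivity) (by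
        have := Real.rpow_nonneg (show (0 : ℝ) ≤ 1 + s by linarith) p
        have := Real.rpow_nonneg (show (0 : ℝ) ≤ 1 - s by linarith) p
        linarith), ← Real.rpow_mul hm0.le, mul_div_cancel₀ _ (by linarith : p ≠ 0)]
    norm_num
  rw [hR]
  have hL : (1 + ρ) / 4 * (a ^ 2 + b ^ 2) + (1 - ρ) / 2 * (a * b) = m ^ 2 * (1 + ρ * s ^ 2) := by
    conv_lhs => rw [hA, hB]
    ring
  rw [hL]
  gcongr

/-- The matrix with rows `(1 - θ, θ)` and `(θ, 1 - θ)` is positive semidefinite for `θ ≤ 1 / 2`.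
Cauchy–Schwarz for its bilinear form leaves one quadratic form for each of the two functions,
bounded by `two_point_quadratic`. -/
lemma two_point {p θ a b c d : ℝ} (hp1 : 1 ≤ p) (hp2 : p ≤ 2) (hθ : θ ≤ 1 / 2)
    (hρ : 1 - 2 * θ ≤ p - 1) (ha : 0 ≤ a) (hb : 0 ≤ b) (hc : 0 ≤ c) (hd : 0 ≤ d) :
    (1 - θ) * (a * c) + θ * (a * d) + θ * (b * c) + (1 - θ) * (b * d) ≤
      2 * (((a ^ p + b ^ p) / 2) ^ (1 / p) * ((c ^ p + d ^ p) / 2) ^ (1 / p)) := by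
  have hρ0 : 0 ≤ 1 - 2 * θ := by linarith
  have h1 := two_point_quadratic hp1 hp2 hρ0 hρ ha hb
  have h2 := two_point_quadratic hp1 hp2 hρ0 hρ hc hd
  have hsq : ∀ t : ℝ, 0 ≤ t → t ^ (2 / p) = (t ^ (1 / p)) ^ 2 := by
    intro t ht
    rw [← Real.rpow_natCast, ← Real.rpow_mul ht]
    congr 1
    push_cast
    ring
  rw [hsq _ (by positivity)] at h1 h2
  set X := ((a ^ p + b ^ p) / 2) ^ (1 / p)
  set Y := ((c ^ p + d ^ p) / 2) ^ (1 / p)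
  have hX : 0 ≤ X := by positivity
  have hY : 0 ≤ Y := by positivity
  have hq : ((1 - θ) * (a * c) + θ * (a * d) + θ * (b * c) + (1 - θ) * (b * d)) ^ 2 ≤
      4 * ((X ^ 2) * (Y ^ 2)) := by
    set ρ := 1 - 2 * θ with hρd
    have hth : θ = (1 - ρ) / 2 := by rw [hρd]; ring
    calc ((1 - θ) * (a * c) + θ * (a * d) + θ * (b * c) + (1 - θ) * (b * d)) ^ 2
        ≤ 4 * (((1 + ρ) / 4 * (a ^ 2 + b ^ 2) + (1 - ρ) / 2 * (a * b)) *
            ((1 + ρ) / 4 * (c ^ 2 + d ^ 2) + (1 - ρ) / 2 * (c * d))) := by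
          rw [hth]
          -- Four times the slack in Cauchy–Schwarz.
          have : 0 ≤ ρ * ((a - b) * (c + d) - (c - d) * (a + b)) ^ 2 := by positivity
          nlinarith
      _ ≤ _ := by
          have : ρ ≤ 1 := by linarith
          gcongr
  refine le_of_sq_le_sq ?_ (by positivity)
  nlinarith

/-- The probability that independent noise of rate `θ` turns one string of length `n` into
another at distance `d`. -/
noncomputable def noiseWeight (θ : ℝ) (n d : ℕ) : ℝ := θ ^ d * (1 - θ) ^ (n - d)

lemma hammingDist_cons {n : ℕ} (i j : Bool) (x y : Fin n → Bool) :
    hammingDist (Fin.cons i x : Fin (n + 1) → Bool) (Fin.cons j y : Fin (n + 1) → Bool) =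
      (if i = j then 0 else 1) + hammingDist x y := by
  simp only [hammingDist, Finset.card_filter, Fin.sum_univ_succ, Fin.cons_zero, Fin.cons_succ]
  congr 1
  simp

lemma sum_cube_succ {n : ℕ} (F : (Fin (n + 1) → Bool) → ℝ) :
    ∑ x, F x = ∑ x : Fin n → Bool, F (Fin.cons false x : Fin (n + 1) → Bool) +
      ∑ x : Fin n → Bool, F (Fin.cons true x : Fin (n + 1) → Bool) := by
  rw [← (Fin.consEquiv fun _ => Bool).sum_comp, Fintype.sum_prod_type, Fintype.sum_bool, add_comm]
  rfl

/-- Two-function hypercontractivity on the cube. -/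
theorem noise_form_le {p θ : ℝ} (hp1 : 1 ≤ p) (hp2 : p ≤ 2) (hθ0 : 0 ≤ θ) (hθ : θ ≤ 1 / 2)
    (hρ : 1 - 2 * θ ≤ p - 1) (n : ℕ) (f g : (Fin n → Bool) → ℝ) (hf : ∀ x, 0 ≤ f x)
    (hg : ∀ x, 0 ≤ g x) :
    ∑ x, ∑ y, noiseWeight θ n (hammingDist x y) * (f x * g y) ≤
      2 ^ n * (((∑ x, f x ^ p) / 2 ^ n) ^ (1 / p) * ((∑ x, g x ^ p) / 2 ^ n) ^ (1 / p)) := by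
  induction n with
  | zero =>
    simp only [Fintype.sum_unique, noiseWeight]
    have hp0 : p ≠ 0 := by linarith
    simp [hf, hg, Real.rpow_rpow_inv, hp0]
  | succ n ih =>
    have hp0 : p ≠ 0 := by linarith
    have hw0 : ∀ x y : Fin n → Bool, noiseWeight θ (n + 1) (0 + hammingDist x y) =
        (1 - θ) * noiseWeight θ n (hammingDist x y) := by
      intro x y
      have := hammingDist_le_card_fintype (x := x) (y := y)
      rw [Fintype.card_fin] at this
      rw [noiseWeight, noiseWeight, zero_add, Nat.succ_sub this, pow_succ]
      ring
    have hw1 : ∀ x y : Fin n → Bool, noiseWeight θ (n + 1) (1 + hammingDist x y) =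
        θ * noiseWeight θ n (hammingDist x y) := by
      intro x y
      rw [noiseWeight, noiseWeight, add_comm 1, Nat.add_sub_add_right, pow_succ]
      ring
    have hθ1 : 0 ≤ 1 - θ := by linarith
    -- Tensorization: the induction hypothesis handles the four pairs of slices given by the first
    -- coordinate, and `two_point` is then applied to the norms of the slices.
    let F : Bool → (Fin n → Bool) → ℝ := fun i x => f (Fin.cons i x : Fin (n + 1) → Bool)
    let G : Bool → (Fin n → Bool) → ℝ := fun i x => g (Fin.cons i x : Fin (n + 1) → Bool)
    let S : Bool → Bool → ℝ := fun i j =>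
      ∑ x, ∑ y, noiseWeight θ n (hammingDist x y) * (F i x * G j y)
    let A : Bool → ℝ := fun i => ((∑ x, F i x ^ p) / 2 ^ n) ^ (1 / p)
    let C : Bool → ℝ := fun i => ((∑ x, G i x ^ p) / 2 ^ n) ^ (1 / p)
    have hS : ∀ i j, S i j ≤ 2 ^ n * (A i * C j) := fun i j =>
      ih (F i) (G j) (fun _ => hf _) (fun _ => hg _)
    have hFs : ∀ i, 0 ≤ (∑ x, F i x ^ p) / 2 ^ n := fun i =>
      div_nonneg (Finset.sum_nonneg fun x _ => Real.rpow_nonneg (hf _) _) (by positivity)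
    have hGs : ∀ i, 0 ≤ (∑ x, G i x ^ p) / 2 ^ n := fun i =>
      div_nonneg (Finset.sum_nonneg fun x _ => Real.rpow_nonneg (hg _) _) (by positivity)
    have hA0 : ∀ i, 0 ≤ A i := fun i => Real.rpow_nonneg (hFs i) _
    have hC0 : ∀ i, 0 ≤ C i := fun i => Real.rpow_nonneg (hGs i) _
    have hAp : ∀ i, A i ^ p = (∑ x, F i x ^ p) / 2 ^ n := fun i => by
      simp only [A]
      rw [one_div, Real.rpow_inv_rpow (hFs i) hp0]
    have hCp : ∀ i, C i ^ p = (∑ x, G i x ^ p) / 2 ^ n := fun i => by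
      simp only [C]
      rw [one_div, Real.rpow_inv_rpow (hGs i) hp0]
    have hf' : (∑ x, f x ^ p) / 2 ^ (n + 1) = (A false ^ p + A true ^ p) / 2 := by
      rw [hAp, hAp, sum_cube_succ, pow_succ]
      field_simp
      rfl
    have hg' : (∑ x, g x ^ p) / 2 ^ (n + 1) = (C false ^ p + C true ^ p) / 2 := by
      rw [hCp, hCp, sum_cube_succ, pow_succ]
      field_simp
      rfl
    have hsum : ∑ x, ∑ y, noiseWeight θ (n + 1) (hammingDist x y) * (f x * g y) =
        (1 - θ) * S false false + θ * S false true + θ * S true false +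
          (1 - θ) * S true true := by
      simp only [sum_cube_succ, hammingDist_cons, S, F, G, Finset.sum_add_distrib,
        Finset.mul_sum, if_true, Bool.false_eq_true, Bool.true_eq_false, if_false, hw0, hw1,
        mul_assoc]
      ring
    rw [hsum, hf', hg']
    have key := two_point hp1 hp2 hθ hρ (hA0 false) (hA0 true) (hC0 false) (hC0 true)
    calc (1 - θ) * S false false + θ * S false true + θ * S true false + (1 - θ) * S true true
        ≤ (1 - θ) * (2 ^ n * (A false * C false)) + θ * (2 ^ n * (A false * C true)) +
            θ * (2 ^ n * (A true * C false)) + (1 - θ) * (2 ^ n * (A true * C true)) := by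
          gcongr <;> exact hS _ _
      _ = 2 ^ n * ((1 - θ) * (A false * C false) + θ * (A false * C true) +
            θ * (A true * C false) + (1 - θ) * (A true * C true)) := by ring
      _ ≤ 2 ^ n * (2 * (((A false ^ p + A true ^ p) / 2) ^ (1 / p) *
            ((C false ^ p + C true ^ p) / 2) ^ (1 / p))) := by gcongr
      _ = _ := by rw [pow_succ]; ring

/-! ### Binomial coefficients -/

/-- The ratio of consecutive terms is `(n - k) d / ((k + 1) (n - d))`, at least one for `k < d` and
at most one for `k ≥ d`. -/
lemma binomial_term_step_up {n d k : ℕ} (hd : d ≤ n) (hk : k < d) :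
    n.choose k * (d ^ k * (n - d) ^ (n - k)) ≤
      n.choose (k + 1) * (d ^ (k + 1) * (n - d) ^ (n - (k + 1))) := by
  refine Nat.le_of_mul_le_mul_left ?_ (show 0 < k + 1 by omega)
  have h1 := Nat.choose_succ_right_eq n k
  have h2 : n - k = (n - (k + 1)) + 1 := by omega
  calc (k + 1) * (n.choose k * (d ^ k * (n - d) ^ (n - k)))
      = ((k + 1) * (n - d)) * (n.choose k * (d ^ k * (n - d) ^ (n - (k + 1)))) := by
        rw [h2]; ring
    _ ≤ (d * (n - k)) * (n.choose k * (d ^ k * (n - d) ^ (n - (k + 1)))) :=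
        Nat.mul_le_mul_right _ (Nat.mul_le_mul hk (by omega))
    _ = (n.choose k * (n - k)) * (d ^ (k + 1) * (n - d) ^ (n - (k + 1))) := by ring
    _ = _ := by rw [← h1]; ring

lemma binomial_term_step_down {n d k : ℕ} (hd : d ≤ k) (hk : k < n) :
    n.choose (k + 1) * (d ^ (k + 1) * (n - d) ^ (n - (k + 1))) ≤
      n.choose k * (d ^ k * (n - d) ^ (n - k)) := by
  refine Nat.le_of_mul_le_mul_left ?_ (show 0 < k + 1 by omega)
  have h1 := Nat.choose_succ_right_eq n k
  have h2 : n - k = (n - (k + 1)) + 1 := by omega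
  calc (k + 1) * (n.choose (k + 1) * (d ^ (k + 1) * (n - d) ^ (n - (k + 1))))
      = (n.choose (k + 1) * (k + 1)) * (d ^ (k + 1) * (n - d) ^ (n - (k + 1))) := by ring
    _ = (d * (n - k)) * (n.choose k * (d ^ k * (n - d) ^ (n - (k + 1)))) := by rw [h1]; ring
    _ ≤ ((k + 1) * (n - d)) * (n.choose k * (d ^ k * (n - d) ^ (n - (k + 1)))) :=
        Nat.mul_le_mul_right _ (Nat.mul_le_mul (by omega) (by omega))
    _ = _ := by rw [h2]; ring

/-- The binomial distribution with mean `d` has its mode at `d`. -/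
lemma binomial_term_le_mode {n d k : ℕ} (hd : d ≤ n) (hk : k ≤ n) :
    n.choose k * (d ^ k * (n - d) ^ (n - k)) ≤ n.choose d * (d ^ d * (n - d) ^ (n - d)) := by
  rcases le_total k d with h | h
  · induction h using Nat.decreasingInduction with
    | self => exact le_rfl
    | of_succ j hj ih => exact (binomial_term_step_up hd hj).trans (ih (by omega))
  · induction k, h using Nat.le_induction with
    | base => exact le_rfl
    | succ j hj ih => exact (binomial_term_step_down hj (by omega)).trans (ih (by omega))

lemma pow_self_le_choose_mul {n d : ℕ} (hd : d ≤ n) :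
    n ^ n ≤ (n + 1) * (n.choose d * (d ^ d * (n - d) ^ (n - d))) := by
  calc n ^ n = (d + (n - d)) ^ n := by rw [Nat.add_sub_cancel' hd]
    _ = ∑ k ∈ Finset.range (n + 1), d ^ k * (n - d) ^ (n - k) * n.choose k := add_pow _ _ _
    _ ≤ ∑ _k ∈ Finset.range (n + 1), n.choose d * (d ^ d * (n - d) ^ (n - d)) := by
        refine Finset.sum_le_sum fun k hk => ?_
        rw [mul_comm]
        exact binomial_term_le_mode hd (by simpa [Nat.lt_succ_iff] using hk)
    _ = _ := by simp

lemma noiseWeight_pos {θ : ℝ} (hθ0 : 0 < θ) (hθ1 : θ < 1) (n d : ℕ) : 0 < noiseWeight θ n d :=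
  mul_pos (pow_pos hθ0 _) (pow_pos (by linarith) _)

lemma choose_mul_noiseWeight_le_one {θ : ℝ} (hθ0 : 0 < θ) (hθ1 : θ < 1) {n d : ℕ} (hd : d ≤ n) :
    n.choose d * noiseWeight θ n d ≤ 1 := by
  have h1 : (0 : ℝ) ≤ 1 - θ := by linarith
  calc (n.choose d : ℝ) * noiseWeight θ n d
      = θ ^ d * (1 - θ) ^ (n - d) * n.choose d := by rw [noiseWeight]; ring
    _ ≤ ∑ k ∈ Finset.range (n + 1), θ ^ k * (1 - θ) ^ (n - k) * n.choose k :=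
        Finset.single_le_sum (f := fun k => θ ^ k * (1 - θ) ^ (n - k) * (n.choose k : ℝ))
          (fun k _ => by positivity) (by simpa [Nat.lt_succ_iff] using hd)
    _ = (θ + (1 - θ)) ^ n := (add_pow _ _ _).symm
    _ = 1 := by simp

lemma le_of_near_mul {θ : ℝ} (hθ : θ < 1 / 2) {n d : ℕ} (hn : 1 ≤ n)
    (hd : |(d : ℝ) - θ * n| < 1) : d ≤ n := by
  have h1 : (1 : ℝ) ≤ n := by exact_mod_cast hn
  have h2 := (abs_lt.1 hd).2
  have : (d : ℝ) < n + 1 := by nlinarith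
  exact Nat.lt_succ_iff.1 (by exact_mod_cast this)

/-- Used to replace `d` by `θn` in `d ^ d` (and `n - d` by `(1 - θ) n`) at the cost of an
exponential factor, with no exception at `t = 0`. -/
lemma le_mul_exp {t u : ℝ} (hu : 0 < u) : t ≤ u * Real.exp (t / u - 1) := by
  have := Real.add_one_le_exp (t / u - 1)
  calc t = u * (t / u - 1 + 1) := by field_simp; ring
    _ ≤ _ := by gcongr

/-- A lower bound for a central term of the binomial distribution. -/
lemma exp_neg_le_choose_mul_noiseWeight {θ : ℝ} (hθ0 : 0 < θ) (hθ : θ < 1 / 2) {n d : ℕ}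
    (hn : 1 ≤ n) (hd : |(d : ℝ) - θ * n| < 1) :
    Real.exp (-(1 / (θ * (1 - θ)))) ≤ (n + 1) * (n.choose d * noiseWeight θ n d) := by
  have hdn := le_of_near_mul hθ hn hd
  have hn1 : (1 : ℝ) ≤ n := by exact_mod_cast hn
  have hn0 : (0 : ℝ) < n := by linarith
  have hθ1 : 0 < 1 - θ := by linarith
  have h0 : (n : ℝ) ^ n ≤ (n + 1) * (n.choose d * ((d : ℝ) ^ d * ((n : ℝ) - d) ^ (n - d))) := by
    have := pow_self_le_choose_mul hdn
    have h2 : ((n : ℝ) - d) = ((n - d : ℕ) : ℝ) := by rw [Nat.cast_sub hdn]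
    rw [h2]
    exact_mod_cast this
  have hnd : (0 : ℝ) ≤ (n : ℝ) - d := by
    have : (d : ℝ) ≤ n := by exact_mod_cast hdn
    linarith
  have h1 : (d : ℝ) ^ d ≤ (θ * n * Real.exp (d / (θ * n) - 1)) ^ d :=
    pow_le_pow_left₀ (by positivity) (le_mul_exp (by positivity)) _
  have h2 : ((n : ℝ) - d) ^ (n - d) ≤
      ((1 - θ) * n * Real.exp ((n - d) / ((1 - θ) * n) - 1)) ^ (n - d) :=
    pow_le_pow_left₀ hnd (le_mul_exp (by positivity)) _
  have h3 : (θ * n * Real.exp (d / (θ * n) - 1)) ^ d *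
      ((1 - θ) * n * Real.exp ((n - d) / ((1 - θ) * n) - 1)) ^ (n - d) ≤
      n ^ n * (noiseWeight θ n d * Real.exp (1 / (θ * (1 - θ)))) := by
    have e1 : (n : ℝ) ^ n = n ^ d * n ^ (n - d) := by rw [← pow_add, Nat.add_sub_cancel' hdn]
    have e2 : (θ * n * Real.exp (d / (θ * n) - 1)) ^ d *
        ((1 - θ) * n * Real.exp ((n - d) / ((1 - θ) * n) - 1)) ^ (n - d) =
        n ^ n * (noiseWeight θ n d * Real.exp (d * (d / (θ * n) - 1) +
          (n - d) * ((n - d) / ((1 - θ) * n) - 1))) := by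
      rw [mul_pow, mul_pow, mul_pow, mul_pow, ← Real.exp_nat_mul, ← Real.exp_nat_mul, e1,
        Real.exp_add, noiseWeight, Nat.cast_sub hdn]
      ring
    rw [e2]
    have hw := noiseWeight_pos hθ0 (by linarith) n d
    gcongr
    -- The errors of first order in `d - θn` cancel. What remains is a chi-square distance, bounded
    -- since `|d - θn| < 1`.
    have e3 : (d : ℝ) * (d / (θ * n) - 1) + (n - d) * ((n - d) / ((1 - θ) * n) - 1) =
        (d - θ * n) ^ 2 / n / (θ * (1 - θ)) := by
      field_simp
      ring
    rw [e3]
    gcongr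
    rw [div_le_one hn0]
    have := (sq_lt_one_iff_abs_lt_one _).2 hd
    linarith
  have h4 : (n : ℝ) ^ n * 1 ≤
      n ^ n * ((n + 1) * (n.choose d * noiseWeight θ n d) * Real.exp (1 / (θ * (1 - θ)))) := by
    calc (n : ℝ) ^ n * 1 ≤ (n + 1) * (n.choose d * ((d : ℝ) ^ d * ((n : ℝ) - d) ^ (n - d))) := by
          rw [mul_one]; exact h0
      _ ≤ (n + 1) * (n.choose d * (n ^ n * (noiseWeight θ n d * Real.exp (1 / (θ * (1 - θ)))))) := by
          refine mul_le_mul_of_nonneg_left (mul_le_mul_of_nonneg_left ?_ (by positivity))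
            (by positivity)
          exact (mul_le_mul h1 h2 (by positivity) (by positivity)).trans h3
      _ = _ := by ring
  have h5 := le_of_mul_le_mul_left h4 (by positivity)
  rw [Real.exp_neg, inv_le_iff_one_le_mul₀ (Real.exp_pos _)]
  exact h5

/-- At `d ≈ θn` the weight is `exp (-n H(θ))` up to a constant factor, which is how the entropy
enters the size of the sphere. -/
lemma log_noiseWeight {θ : ℝ} (hθ0 : 0 < θ) (hθ1 : θ < 1) {n d : ℕ} (hd : d ≤ n) :
    Real.log (noiseWeight θ n d) =
      (d - θ * n) * (Real.log θ - Real.log (1 - θ)) - n * Real.binEntropy θ := by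
  have h1 : 0 < 1 - θ := by linarith
  rw [noiseWeight, Real.log_mul (by positivity) (by positivity), Real.log_pow, Real.log_pow,
    Real.binEntropy_eq_negMulLog_add_negMulLog_one_sub, Real.negMulLog, Real.negMulLog,
    Nat.cast_sub hd]
  ring

/-- If the entropy of `θ` is one half, then the logarithm of the size of a sphere of radius
`θ n` is `n / 2` up to a logarithmic term. -/
lemma exists_clog_choose_near {θ : ℝ} (hθ0 : 0 < θ) (hθ : θ < 1 / 2)
    (hent : Real.binEntropy θ / Real.log 2 = 1 / 2) :
    ∃ c : ℝ, 0 ≤ c ∧ ∀ n d : ℕ, 1 ≤ n → |(d : ℝ) - θ * n| < 1 →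
      (Nat.clog 2 (n.choose d) : ℝ) ≤ n / 2 + c ∧
      n / 2 - c - 2 * Real.log (n + 1) ≤ Nat.clog 2 (n.choose d) := by
  have hl2 : 0 < Real.log 2 := Real.log_pos (by norm_num)
  have hH : Real.binEntropy θ = Real.log 2 / 2 := by
    field_simp at hent
    linarith
  have hθ1 : 0 < 1 - θ := by linarith
  set L := Real.log (1 - θ) - Real.log θ with hL
  have hL0 : 0 ≤ L := sub_nonneg.2 (Real.log_le_log hθ0 (by linarith))
  set E := 1 / (θ * (1 - θ)) with hE
  have hE0 : 0 ≤ E := by positivity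
  refine ⟨(L + E) / Real.log 2 + 1, by positivity, fun n d hn hd => ?_⟩
  have hdn := le_of_near_mul hθ hn hd
  have hw := noiseWeight_pos hθ0 (by linarith) n d
  have hB : (1 : ℝ) ≤ n.choose d := by exact_mod_cast Nat.choose_pos hdn
  have hlw := log_noiseWeight hθ0 (by linarith) hdn
  rw [hH] at hlw
  have hab : |(d - θ * n) * (Real.log θ - Real.log (1 - θ))| ≤ L := by
    rw [abs_mul, abs_sub_comm (Real.log θ), abs_of_nonneg hL0]
    calc _ ≤ 1 * L := by gcongr
      _ = L := one_mul _
  have hab := abs_le.1 hab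
  have h1 : Real.log (n.choose d) + Real.log (noiseWeight θ n d) ≤ 0 := by
    rw [← Real.log_mul (by positivity) hw.ne']
    exact Real.log_nonpos (by positivity) (choose_mul_noiseWeight_le_one hθ0 (by linarith) hdn)
  have h2 : -E ≤ Real.log (n + 1) + (Real.log (n.choose d) + Real.log (noiseWeight θ n d)) := by
    rw [← Real.log_mul (by positivity) hw.ne', ← Real.log_mul (by positivity) (by positivity),
      Real.le_log_iff_exp_le (by positivity)]
    exact exp_neg_le_choose_mul_noiseWeight hθ0 hθ hn hd
  have h3 : Real.log (n.choose d) ≤ Nat.clog 2 (n.choose d) * Real.log 2 := by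
    rw [← Real.log_pow]
    refine Real.log_le_log (by positivity) ?_
    exact_mod_cast Nat.le_pow_clog (by norm_num) _
  have h4 : (Nat.clog 2 (n.choose d) - 1) * Real.log 2 ≤ Real.log (n.choose d) := by
    rcases Nat.lt_or_ge (n.choose d) 2 with h | h
    · have : n.choose d = 1 := by
        have := Nat.choose_pos hdn
        omega
      rw [this]
      simp
      exact hl2.le
    · have h5 := Nat.pow_pred_clog_lt_self (b := 2) (by norm_num) (x := n.choose d) (by omega)
      have h6 : 0 < Nat.clog 2 (n.choose d) := Nat.clog_pos (by norm_num) h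
      have : ((Nat.clog 2 (n.choose d) - 1 : ℕ) : ℝ) = Nat.clog 2 (n.choose d) - 1 := by
        rw [Nat.cast_sub h6]; simp
      rw [← this, ← Real.log_pow]
      refine Real.log_le_log (by positivity) ?_
      exact_mod_cast h5.le
  -- Accounts for the factor `2` in front of `log (n + 1)`: changing to base two divides by `log 2`.
  have hl2' : 1 / 2 ≤ Real.log 2 := by linarith [Real.log_two_gt_d9]
  have hln : 0 ≤ Real.log (n + 1 : ℝ) := Real.log_nonneg (by linarith [Nat.cast_nonneg (α := ℝ) n])
  have hX : (L + E) / Real.log 2 * Real.log 2 = L + E := by field_simp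
  constructor
  · refine le_of_mul_le_mul_right ?_ hl2
    nlinarith
  · refine le_of_mul_le_mul_right ?_ hl2
    nlinarith

/-! ### The complexity of the inputs and of the keys -/

lemma computable_decide_eq {α β : Type*} [Primcodable α] [Primcodable β] [DecidableEq β]
    {f g : α → β} (hf : Computable f) (hg : Computable g) :
    Computable fun a => decide (f a = g a) :=
  (Primrec.beq (α := β)).to_comp.comp hf hg

lemma computable_not {α : Type*} [Primcodable α] {f : α → Bool} (hf : Computable f) :
    Computable fun a => !f a :=
  Primrec.not.to_comp.comp hf

lemma computable_and {α : Type*} [Primcodable α] {f g : α → Bool} (hf : Computable f)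
    (hg : Computable g) : Computable fun a => f a && g a :=
  Primrec.and.to_comp.comp hf hg

lemma computable_decide_le {α : Type*} [Primcodable α] {f g : α → ℕ} (hf : Computable f)
    (hg : Computable g) : Computable fun a => decide (f a ≤ g a) :=
  (Primrec.nat_le.decide.to_comp.comp hf hg).of_eq fun a => by
    simp

/-- The Hamming distance of two strings of the same length. -/
def listDist (x y : List Bool) : ℕ := countBelow (fun i => !decide (x[i]? = y[i]?)) x.length

lemma computable_listDist : Computable fun q : List Bool × List Bool => listDist q.1 q.2 := by
  unfold listDist
  refine computable_countBelow (f := fun (q : List Bool × List Bool) i => !decide (q.1[i]? = q.2[i]?)) ?_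
    (Computable.list_length.comp Computable.fst)
  refine Computable₂.mk (computable_not (computable_decide_eq
    (Computable.list_getElem?.comp (Computable.fst.comp Computable.fst) Computable.snd)
    (Computable.list_getElem?.comp (Computable.snd.comp Computable.fst) Computable.snd)))

lemma listDist_ofFn {n : ℕ} (x y : Fin n → Bool) :
    listDist (List.ofFn x) (List.ofFn y) = hammingDist x y := by
  rw [listDist, countBelow_eq, hammingDist, Finset.card_filter, Finset.card_filter,
    List.length_ofFn, Finset.sum_range]
  simp

attribute [irreducible] listDist

lemma exists_ofFn_eq {n : ℕ} {z : List Bool} (h : z.length = n) :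
    ∃ x : Fin n → Bool, List.ofFn x = z := by
  subst h
  exact ⟨z.get, List.ofFn_get z⟩

lemma card_sphere {n : ℕ} (y : Fin n → Bool) (d : ℕ) :
    (Finset.univ.filter fun x : Fin n → Bool => hammingDist x y = d).card = n.choose d := by
  have hcard : n.choose d = (Finset.powersetCard d (Finset.univ : Finset (Fin n))).card := by
    simp
  rw [hcard]
  refine Finset.card_bij' (fun x _ => Finset.univ.filter fun i => x i ≠ y i)
    (fun s _ i => if i ∈ s then !y i else y i) ?_ ?_ ?_ ?_
  · intro x hx
    rw [Finset.mem_powersetCard]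
    exact ⟨Finset.subset_univ _, (Finset.mem_filter.1 hx).2⟩
  · intro s hs
    rw [Finset.mem_powersetCard] at hs
    rw [Finset.mem_filter]
    refine ⟨Finset.mem_univ _, ?_⟩
    rw [← hs.2, hammingDist]
    congr 1
    ext i
    by_cases h : i ∈ s <;> simp [h]
  · intro x _
    funext i
    by_cases h : x i = y i <;> simp [h]
    cases hx : x i <;> cases hy : y i <;> simp_all
  · intro s _
    ext i
    by_cases h : i ∈ s <;> simp [h]

lemma card_pairs_at_distance (n d : ℕ) :
    (Finset.univ.filter fun q : (Fin n → Bool) × (Fin n → Bool) =>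
      hammingDist q.1 q.2 = d).card = 2 ^ n * n.choose d := by
  rw [Finset.card_filter, Fintype.sum_prod_type_right]
  simp_rw [← Finset.card_filter, card_sphere]
  simp

lemma pair_lt_two_pow {a b l : ℕ} (ha : a < 2 ^ l) (hb : b < 2 ^ l) :
    Nat.pair a b < 2 ^ (2 * l) := by
  refine (Nat.pair_lt_max_add_one_sq a b).trans_le ?_
  rw [mul_comm, pow_mul]
  refine Nat.pow_le_pow_left ?_ 2
  exact max_lt ha hb

variable {U : Machine}

/-- Given `y`, the string `x` is determined by `d` and its rank in the sphere of radius `d` around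
`y`. -/
lemma IsOptimal.condComplexity_le_of_dist (hU : IsOptimal U) :
    ∃ c : ℕ, ∀ (n d l : ℕ) (x y : Fin n → Bool), hammingDist x y = d → d < 2 ^ l →
      condComplexity U (List.ofFn x) (List.ofFn y) ≤ 2 * l + Nat.clog 2 (n.choose d) + c := by
  let R : ℕ × List Bool × List Bool → Bool := fun a =>
    decide (a.2.2.length = a.2.1.length) && decide (listDist a.2.2 a.2.1 = a.1)
  have hR : Computable R := by
    refine computable_and (computable_decide_eq
      (Computable.list_length.comp (Computable.snd.comp Computable.snd))
      (Computable.list_length.comp (Computable.fst.comp Computable.snd)))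
      (computable_decide_eq
        (computable_listDist.comp ((Computable.snd.comp Computable.snd).pair
          (Computable.fst.comp Computable.snd))) Computable.fst)
  obtain ⟨c, hc⟩ := hU.condComplexity_le_of_card hR
  refine ⟨c, fun n d l x y hxy hd => ?_⟩
  refine hc d _ _ ((Finset.univ.filter fun x : Fin n → Bool => hammingDist x y = d).image
    List.ofFn) l _ ?_ ?_ hd ?_
  · simp [R, listDist_ofFn, hxy]
  · intro w hw
    simp only [R, Bool.and_eq_true, decide_eq_true_eq, List.length_ofFn] at hw
    obtain ⟨v, rfl⟩ := exists_ofFn_eq hw.1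
    rw [listDist_ofFn] at hw
    exact Finset.mem_image_of_mem _ (by simpa using hw.2)
  · refine Finset.card_image_le.trans ?_
    rw [card_sphere]
    exact Nat.le_pow_clog (by norm_num) _

/-- The pair is described by `(n, d)` and its rank among the `2 ^ n * n.choose d` pairs at distance
`d`. -/
lemma IsOptimal.pairComplexity_le_of_dist (hU : IsOptimal U)
    {e : List Bool × List Bool ≃ List Bool} (he : e.Computable) :
    ∃ c : ℕ, ∀ (n d l : ℕ) (x y : Fin n → Bool), hammingDist x y = d → n < 2 ^ l → d < 2 ^ l →
      pairComplexity U e (List.ofFn x) (List.ofFn y) ≤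
        4 * l + (n + Nat.clog 2 (n.choose d)) + c := by
  let R : (ℕ × ℕ) × List Bool × List Bool → Bool := fun a =>
    (decide ((e.symm a.2.2).1.length = a.1.1) && decide ((e.symm a.2.2).2.length = a.1.1)) &&
      decide (listDist (e.symm a.2.2).1 (e.symm a.2.2).2 = a.1.2)
  have hR : Computable R := by
    have he' : Computable fun a : (ℕ × ℕ) × List Bool × List Bool => e.symm a.2.2 :=
      he.2.comp (Computable.snd.comp Computable.snd)
    exact computable_and
      (computable_and
        (computable_decide_eq
          (Computable.list_length.comp (Computable.fst.comp he'))
          (Computable.fst.comp Computable.fst))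
        (computable_decide_eq
          (Computable.list_length.comp (Computable.snd.comp he'))
          (Computable.fst.comp Computable.fst)))
      (computable_decide_eq (computable_listDist.comp he')
        (Computable.snd.comp Computable.fst))
  obtain ⟨c, hc⟩ := hU.condComplexity_le_of_card hR
  refine ⟨c, fun n d l x y hxy hn hd => ?_⟩
  have := hc (n, d) [] (e (List.ofFn x, List.ofFn y))
    ((Finset.univ.filter fun q : (Fin n → Bool) × (Fin n → Bool) =>
      hammingDist q.1 q.2 = d).image fun q => e (List.ofFn q.1, List.ofFn q.2)) (2 * l)
    (n + Nat.clog 2 (n.choose d)) ?_ ?_ ?_ ?_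
  · rw [pairComplexity, complexity]
    omega
  · simp [R, listDist_ofFn, hxy]
  · intro w hw
    simp only [R, Bool.and_eq_true, decide_eq_true_eq] at hw
    obtain ⟨u, hu⟩ := exists_ofFn_eq hw.1.1
    obtain ⟨v, hv⟩ := exists_ofFn_eq hw.1.2
    refine Finset.mem_image.2 ⟨(u, v), ?_, ?_⟩
    · rw [← hu, ← hv, listDist_ofFn] at hw
      simpa using hw.2
    · simp only [hu, hv]
      simp
  · exact pair_lt_two_pow hn hd
  · refine Finset.card_image_le.trans ?_
    rw [card_pairs_at_distance, pow_add]
    exact Nat.mul_le_mul_left _ (Nat.le_pow_clog (by norm_num) _)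

/-! ### Computing the distribution of a party's answer. -/

/-- The binary digits of `j` from the position `i` to the position `i + n - 1`. -/
def digits (j i n : ℕ) : List Bool := (List.range n).map fun k => decide (j / 2 ^ (i + k) % 2 = 1)

lemma primrec_two_pow : Primrec fun k : ℕ => 2 ^ k :=
  Primrec₂.unpaired'.1 Nat.Primrec.pow |>.comp (Primrec.const 2) Primrec.id

lemma primrec_digits : Primrec fun q : ℕ × ℕ × ℕ => digits q.1 q.2.1 q.2.2 := by
  refine Primrec.list_map (Primrec.list_range.comp (Primrec.snd.comp Primrec.snd)) ?_
  refine (Primrec.beq (α := ℕ)).comp ?_ (Primrec.const 1)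
  refine Primrec.nat_mod.comp (Primrec.nat_div.comp (Primrec.fst.comp Primrec.fst)
    (primrec_two_pow.comp (Primrec.nat_add.comp ?_ Primrec.snd))) (Primrec.const 2)
  exact Primrec.fst.comp (Primrec.snd.comp Primrec.fst)

lemma computable_digits {α : Type*} [Primcodable α] {f g h : α → ℕ} (hf : Computable f)
    (hg : Computable g) (hh : Computable h) : Computable fun a => digits (f a) (g a) (h a) :=
  primrec_digits.to_comp.comp (hf.pair (hg.pair hh))

lemma digits_eq_ofFn (j i n : ℕ) : digits j i n = List.ofFn fun k : Fin n => j.testBit (i + k) := by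
  rw [digits, List.ofFn_eq_map, ← List.map_coe_finRange_eq_range, List.map_map]
  refine List.map_congr_left fun k _ => ?_
  simp [Nat.testBit_eq_decide_div_mod_eq]

attribute [irreducible] digits

/-- The pair of strings with the binary digits of `j`. -/
def splitDigits (n m : ℕ) (j : ℕ) : (Fin n → Bool) × (Fin m → Bool) :=
  (fun k => j.testBit k, fun k => j.testBit (n + k))

lemma splitDigits_bijective (n m : ℕ) :
    Function.Bijective fun j : Fin (2 ^ (n + m)) => splitDigits n m j := by
  rw [Fintype.bijective_iff_injective_and_card]
  refine ⟨fun i j hij => ?_, by simp [pow_add]⟩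
  simp only [splitDigits, Prod.mk.injEq] at hij
  refine Fin.ext (Nat.eq_of_testBit_eq fun k => ?_)
  rcases Nat.lt_or_ge k n with h | h
  · exact congrFun hij.1 ⟨k, h⟩
  · rcases Nat.lt_or_ge k (n + m) with h' | h'
    · have := congrFun hij.2 ⟨k - n, by omega⟩
      simpa [Nat.add_sub_cancel' h] using this
    · have hp : 2 ^ (n + m) ≤ 2 ^ k := Nat.pow_le_pow_right (by norm_num) h'
      rw [Nat.testBit_lt_two_pow (i.2.trans_le hp), Nat.testBit_lt_two_pow (j.2.trans_le hp)]

/-- The number of inputs and random strings of a party for which its answer after the transcript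
`t` is `z`. -/
def answerCount (out : Profile × List Bool × List Bool × List Bool → List Bool) (n m : ℕ)
    (a : Profile) (t z : List Bool) : ℕ :=
  (Finset.univ.filter fun q : (Fin n → Bool) × (Fin m → Bool) =>
    out (a, List.ofFn q.1, List.ofFn q.2, t) = z).card

/-- Numbering the pairs of input and random bits by their binary digits exhibits the count as
computable. -/
lemma answerCount_eq (out : Profile × List Bool × List Bool × List Bool → List Bool) (n m : ℕ)
    (a : Profile) (t z : List Bool) : answerCount out n m a t z =
      countBelow (fun j => decide (out (a, digits j 0 n, digits j n m, t) = z)) (2 ^ (n + m)) := by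
  rw [countBelow_eq, answerCount, Finset.card_filter, Finset.card_filter, Finset.sum_range,
    ← (splitDigits_bijective n m).sum_comp fun q =>
      if out (a, List.ofFn q.1, List.ofFn q.2, t) = z then 1 else 0]
  refine Finset.sum_congr rfl fun j _ => ?_
  simp only [digits_eq_ofFn, splitDigits, decide_eq_true_eq, Nat.zero_add]
  congr

/-- An answer which a party gives with probability at least `2 ^ (-s)` has complexity about `s`. -/
lemma IsOptimal.condComplexity_le_of_answerCount (hU : IsOptimal U)
    {out : Profile × List Bool × List Bool × List Bool → List Bool} (hout : Computable out)
    {m : ℕ → ℕ} (hm : Computable m) :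
    ∃ c : ℕ, ∀ (n : ℕ) (a : Profile) (s l : ℕ) (t z : List Bool),
      2 ^ (n + m n) ≤ 2 ^ s * answerCount out n (m n) a t z →
      Encodable.encode (n, a, s) < 2 ^ l → condComplexity U z t ≤ 2 * l + s + c := by
  let R : (ℕ × Profile × ℕ) × List Bool × List Bool → Bool := fun b =>
    decide (2 ^ (b.1.1 + m b.1.1) ≤ 2 ^ b.1.2.2 * countBelow (fun j => decide
      (out (b.1.2.1, digits j 0 b.1.1, digits j b.1.1 (m b.1.1), b.2.1) = b.2.2))
      (2 ^ (b.1.1 + m b.1.1)))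
  have hR : Computable R := by
    have hn : Computable fun b : (ℕ × Profile × ℕ) × List Bool × List Bool => b.1.1 :=
      Computable.fst.comp Computable.fst
    have ha : Computable fun b : (ℕ × Profile × ℕ) × List Bool × List Bool => b.1.2.1 :=
      Computable.fst.comp (Computable.snd.comp Computable.fst)
    have hs : Computable fun b : (ℕ × Profile × ℕ) × List Bool × List Bool => b.1.2.2 :=
      Computable.snd.comp (Computable.snd.comp Computable.fst)
    have hN : Computable fun b : (ℕ × Profile × ℕ) × List Bool × List Bool =>
        2 ^ (b.1.1 + m b.1.1) :=
      primrec_two_pow.to_comp.comp (Primrec.nat_add.to_comp.comp hn (hm.comp hn))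
    refine computable_decide_le hN (Primrec.nat_mul.to_comp.comp
      (primrec_two_pow.to_comp.comp hs) ?_)
    refine computable_countBelow (f := fun (b : (ℕ × Profile × ℕ) × List Bool × List Bool) j =>
      decide (out (b.1.2.1, digits j 0 b.1.1, digits j b.1.1 (m b.1.1), b.2.1) = b.2.2)) ?_ hN
    refine computable_decide_eq (hout.comp ?_)
      (Computable.snd.comp (Computable.snd.comp Computable.fst))
    refine (ha.comp Computable.fst).pair (Computable.pair ?_ (Computable.pair ?_
      (Computable.fst.comp (Computable.snd.comp Computable.fst))))
    · exact computable_digits Computable.snd (Computable.const 0) (hn.comp Computable.fst)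
    · exact computable_digits Computable.snd (hn.comp Computable.fst) ((hm.comp hn).comp Computable.fst)
  obtain ⟨c, hc⟩ := hU.condComplexity_le_of_card hR
  refine ⟨c, fun n a s l t z hz hl => ?_⟩
  have hRiff : ∀ w, R ((n, a, s), t, w) = true ↔
      2 ^ (n + m n) ≤ 2 ^ s * answerCount out n (m n) a t w := by
    intro w
    simp only [R, decide_eq_true_eq, answerCount_eq]
  refine hc (n, a, s) t z ((Finset.univ.image fun q : (Fin n → Bool) × (Fin (m n) → Bool) =>
    out (a, List.ofFn q.1, List.ofFn q.2, t)).filter fun w =>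
      2 ^ (n + m n) ≤ 2 ^ s * answerCount out n (m n) a t w) l s ((hRiff z).2 hz) ?_ hl ?_
  · intro w hw
    rw [hRiff] at hw
    refine Finset.mem_filter.2 ⟨?_, hw⟩
    have hpos : 0 < answerCount out n (m n) a t w := by
      rw [Nat.pos_iff_ne_zero]
      intro h0
      rw [h0, mul_zero] at hw
      exact absurd hw (Nat.not_le.2 (by positivity))
    obtain ⟨q, hq⟩ := Finset.card_pos.1 hpos
    exact Finset.mem_image.2 ⟨q, Finset.mem_univ _, (Finset.mem_filter.1 hq).2⟩
  -- The answers partition the probability space, so at most `2 ^ s` of them have probability at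
  -- least `2 ^ (-s)`.
  · set S := (Finset.univ.image fun q : (Fin n → Bool) × (Fin (m n) → Bool) =>
      out (a, List.ofFn q.1, List.ofFn q.2, t)) with hS
    set S' := S.filter fun w => 2 ^ (n + m n) ≤ 2 ^ s * answerCount out n (m n) a t w
    have hsum : ∑ w ∈ S', answerCount out n (m n) a t w ≤ 2 ^ (n + m n) := by
      calc ∑ w ∈ S', answerCount out n (m n) a t w
          ≤ ∑ w ∈ S, answerCount out n (m n) a t w :=
            Finset.sum_le_sum_of_subset (Finset.filter_subset _ _)
        _ = (Finset.univ : Finset ((Fin n → Bool) × (Fin (m n) → Bool))).card :=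
            (Finset.card_eq_sum_card_image _ _).symm
        _ = 2 ^ (n + m n) := by simp [pow_add]
    refine Nat.le_of_mul_le_mul_left (c := 2 ^ (n + m n)) ?_ (by positivity)
    calc 2 ^ (n + m n) * S'.card = ∑ _w ∈ S', 2 ^ (n + m n) := by simp [mul_comm]
      _ ≤ ∑ w ∈ S', 2 ^ s * answerCount out n (m n) a t w :=
          Finset.sum_le_sum fun w hw => (Finset.mem_filter.1 hw).2
      _ = 2 ^ s * ∑ w ∈ S', answerCount out n (m n) a t w := by rw [Finset.mul_sum]
      _ ≤ 2 ^ s * 2 ^ (n + m n) := Nat.mul_le_mul_left _ hsum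
      _ = 2 ^ (n + m n) * 2 ^ s := mul_comm _ _

/-! ### Agreement on unlikely answers without communication -/

/-- Split `1 / p = 1 / 2 + (1 / p - 1 / 2)`. The excess powers are bounded by those of `τ`, and the
square roots by AM-GM. The result is linear in `α` and `β`, so it can be summed over all answers. -/
lemma rpow_mul_rpow_le {p τ α β : ℝ} (hp1 : 1 ≤ p) (hp2 : p ≤ 2) (hα : 0 ≤ α) (hβ : 0 ≤ β)
    (hατ : α ≤ τ) (hβτ : β ≤ τ) :
    α ^ (1 / p) * β ^ (1 / p) ≤ τ ^ (2 / p - 1) * ((α + β) / 2) := by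
  have hp0 : 0 < p := by linarith
  have hτ : 0 ≤ τ := hα.trans hατ
  have he : 0 ≤ 1 / p - 1 / 2 := by
    rw [sub_nonneg]
    exact one_div_le_one_div_of_le hp0 hp2
  have hsplit : ∀ t : ℝ, 0 ≤ t → t ≤ τ → t ^ (1 / p) ≤ √t * τ ^ (1 / p - 1 / 2) := by
    intro t ht htτ
    calc t ^ (1 / p) = t ^ (1 / 2 + (1 / p - 1 / 2)) := by congr 1; ring
      _ = t ^ (1 / 2 : ℝ) * t ^ (1 / p - 1 / 2) := Real.rpow_add_of_nonneg ht (by norm_num) he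
      _ ≤ √t * τ ^ (1 / p - 1 / 2) := by
          rw [← Real.sqrt_eq_rpow]
          gcongr
  have hsq : τ ^ (2 / p - 1) = τ ^ (1 / p - 1 / 2) * τ ^ (1 / p - 1 / 2) := by
    rw [← Real.rpow_add_of_nonneg hτ he he]
    congr 1
    ring
  have hT : 0 ≤ τ ^ (1 / p - 1 / 2) := Real.rpow_nonneg hτ _
  have hst : √α * √β ≤ (α + β) / 2 := by
    nlinarith [sq_nonneg (√α - √β), Real.sq_sqrt hα, Real.sq_sqrt hβ]
  calc α ^ (1 / p) * β ^ (1 / p)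
      ≤ (√α * τ ^ (1 / p - 1 / 2)) * (√β * τ ^ (1 / p - 1 / 2)) :=
        mul_le_mul (hsplit α hα hατ) (hsplit β hβ hβτ) (by positivity) (by positivity)
    _ = τ ^ (2 / p - 1) * (√α * √β) := by rw [hsq]; ring
    _ ≤ _ := mul_le_mul_of_nonneg_left hst (Real.rpow_nonneg hτ _)

/-- Small-set expansion for the spheres of radius `d`, with fractional sets. -/
lemma sphere_form_le {p θ τ : ℝ} (hp1 : 1 ≤ p) (hp2 : p ≤ 2) (hθ0 : 0 ≤ θ) (hθ : θ ≤ 1 / 2)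
    (hρ : 1 - 2 * θ ≤ p - 1) {n : ℕ} (d : ℕ) (f g : (Fin n → Bool) → ℝ) (hf0 : ∀ x, 0 ≤ f x)
    (hg0 : ∀ x, 0 ≤ g x) (hf1 : ∀ x, f x ≤ 1) (hg1 : ∀ x, g x ≤ 1)
    (hfτ : (∑ x, f x) / 2 ^ n ≤ τ) (hgτ : (∑ x, g x) / 2 ^ n ≤ τ) :
    noiseWeight θ n d * ∑ x, ∑ y, (if hammingDist x y = d then f x * g y else 0) ≤
      τ ^ (2 / p - 1) * ((∑ x, f x + ∑ x, g x) / 2) := by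
  have hp0 : 0 < p := by linarith
  have hθ1 : 0 ≤ 1 - θ := by linarith
  have havg : ∀ h : (Fin n → Bool) → ℝ, (∀ x, 0 ≤ h x) → (∀ x, h x ≤ 1) →
      ((∑ x, h x ^ p) / 2 ^ n) ^ (1 / p) ≤ ((∑ x, h x) / 2 ^ n) ^ (1 / p) := by
    intro h h0 h1
    refine Real.rpow_le_rpow (div_nonneg (Finset.sum_nonneg fun x _ =>
      Real.rpow_nonneg (h0 x) _) (by positivity)) ?_ (by positivity)
    gcongr with x
    exact Real.rpow_le_self_of_le_one (h0 x) (h1 x) hp1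
  have hs0 : ∀ h : (Fin n → Bool) → ℝ, (∀ x, 0 ≤ h x) → 0 ≤ (∑ x, h x) / 2 ^ n := fun h h0 =>
    div_nonneg (Finset.sum_nonneg fun x _ => h0 x) (by positivity)
  calc noiseWeight θ n d * ∑ x, ∑ y, (if hammingDist x y = d then f x * g y else 0)
      ≤ ∑ x, ∑ y, noiseWeight θ n (hammingDist x y) * (f x * g y) := by
        -- Only the terms at distance exactly `d` are kept from the nonnegative noise form.
        simp_rw [Finset.mul_sum]
        refine Finset.sum_le_sum fun x _ => Finset.sum_le_sum fun y _ => ?_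
        split_ifs with h
        · rw [h]
        · rw [mul_zero]
          exact mul_nonneg (by unfold noiseWeight; positivity) (mul_nonneg (hf0 x) (hg0 y))
    _ ≤ 2 ^ n * (((∑ x, f x ^ p) / 2 ^ n) ^ (1 / p) * ((∑ x, g x ^ p) / 2 ^ n) ^ (1 / p)) :=
        noise_form_le hp1 hp2 hθ0 hθ hρ n f g hf0 hg0
    _ ≤ 2 ^ n * (((∑ x, f x) / 2 ^ n) ^ (1 / p) * ((∑ x, g x) / 2 ^ n) ^ (1 / p)) := by
        refine mul_le_mul_of_nonneg_left ?_ (by positivity)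
        refine mul_le_mul (havg f hf0 hf1) (havg g hg0 hg1) (Real.rpow_nonneg ?_ _)
          (Real.rpow_nonneg (hs0 f hf0) _)
        exact div_nonneg (Finset.sum_nonneg fun x _ => Real.rpow_nonneg (hg0 x) _) (by positivity)
    _ ≤ 2 ^ n * (τ ^ (2 / p - 1) * (((∑ x, f x) / 2 ^ n + (∑ x, g x) / 2 ^ n) / 2)) :=
        mul_le_mul_of_nonneg_left
          (rpow_mul_rpow_le hp1 hp2 (hs0 f hf0) (hs0 g hg0) hfτ hgτ) (by positivity)
    _ = _ := by field_simp

/-! ### Agreement of two parties who do not communicate. -/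

section AnswerProb

variable {n : ℕ} {R Z : Type*} [Fintype R] [DecidableEq Z]

/-- The probability of the answer `z` of a party with the input `x`. -/
noncomputable def answerProb (w : (Fin n → Bool) → R → Z) (z : Z) (x : Fin n → Bool) : ℝ :=
  ((Finset.univ.filter fun s => w x s = z).card : ℝ) / (Fintype.card R : ℝ)

lemma answerProb_nonneg (w : (Fin n → Bool) → R → Z) (z : Z) (x : Fin n → Bool) :
    0 ≤ answerProb w z x := by
  unfold answerProb
  positivity

lemma answerProb_le_one (w : (Fin n → Bool) → R → Z) (z : Z) (x : Fin n → Bool) :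
    answerProb w z x ≤ 1 :=
  div_le_one_of_le₀ (by exact_mod_cast Finset.card_le_univ _) (Nat.cast_nonneg _)

lemma sum_answerProb (w : (Fin n → Bool) → R → Z) (z : Z) : ∑ x, answerProb w z x =
    ((Finset.univ.filter fun q : (Fin n → Bool) × R => w q.1 q.2 = z).card : ℝ) /
      (Fintype.card R : ℝ) := by
  simp only [answerProb]
  rw [← Finset.sum_div, Finset.card_filter, Fintype.sum_prod_type]
  simp only [Finset.card_filter]
  push_cast
  rfl

lemma sum_sum_answerProb_le [Nonempty R] (w : (Fin n → Bool) → R → Z) (S : Finset Z) :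
    ∑ z ∈ S, ∑ x, answerProb w z x ≤ 2 ^ n := by
  have hr : (0 : ℝ) < (Fintype.card R : ℝ) := by exact_mod_cast Fintype.card_pos
  simp only [sum_answerProb]
  rw [← Finset.sum_div, div_le_iff₀ hr]
  have h : ∑ z ∈ S, (Finset.univ.filter fun q : (Fin n → Bool) × R => w q.1 q.2 = z).card ≤
      2 ^ n * Fintype.card R := by
    classical
    rw [← Finset.card_biUnion]
    · refine (Finset.card_le_univ _).trans ?_
      simp
    · intro z _ z' _ hzz
      rw [Function.onFun, Finset.disjoint_left]
      intro q hq hq'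
      exact hzz ((Finset.mem_filter.1 hq).2.symm.trans (Finset.mem_filter.1 hq').2)
  exact_mod_cast h

/-- For fixed inputs the private random bits are independent, so the probability that both parties
answer `z` factorizes. -/
lemma card_agree_at_eq [Nonempty R] (d : ℕ) (u v : (Fin n → Bool) → R → Z) (z : Z) :
    ((Finset.univ.filter fun q : ((Fin n → Bool) × (Fin n → Bool)) × (R × R) =>
      hammingDist q.1.1 q.1.2 = d ∧ u q.1.1 q.2.1 = z ∧ v q.1.2 q.2.2 = z).card : ℝ) =
      (Fintype.card R : ℝ) ^ 2 * ∑ x, ∑ y,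
        (if hammingDist x y = d then answerProb u z x * answerProb v z y else 0) := by
  have hr : (0 : ℝ) < (Fintype.card R : ℝ) := by exact_mod_cast Fintype.card_pos
  have hN : (Finset.univ.filter fun q : ((Fin n → Bool) × (Fin n → Bool)) × (R × R) =>
      hammingDist q.1.1 q.1.2 = d ∧ u q.1.1 q.2.1 = z ∧ v q.1.2 q.2.2 = z).card =
      ∑ x : Fin n → Bool, ∑ y : Fin n → Bool,
        (if hammingDist x y = d then (Finset.univ.filter fun s => u x s = z).card *
          (Finset.univ.filter fun s => v y s = z).card else 0) := by
    rw [Finset.card_filter, Fintype.sum_prod_type, Fintype.sum_prod_type]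
    refine Finset.sum_congr rfl fun x _ => Finset.sum_congr rfl fun y _ => ?_
    by_cases h : hammingDist x y = d
    · rw [if_pos h, ← Finset.card_product, ← Finset.card_filter]
      congr 1
      ext s
      simp [h]
    · simp [h]
  rw [hN]
  push_cast
  rw [Finset.mul_sum]
  refine Finset.sum_congr rfl fun x _ => ?_
  rw [Finset.mul_sum]
  refine Finset.sum_congr rfl fun y _ => ?_
  by_cases h : hammingDist x y = d
  · rw [if_pos h, if_pos h, answerProb, answerProb]
    field_simp
  · rw [if_neg h, if_neg h, mul_zero]

/-- Without communication two parties with inputs at distance `d` seldom agree on an answer which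
each of them gives with probability at most `τ`. -/
lemma card_agree_le {p θ τ : ℝ} (hp1 : 1 ≤ p) (hp2 : p ≤ 2) (hθ0 : 0 ≤ θ) (hθ : θ ≤ 1 / 2)
    (hρ : 1 - 2 * θ ≤ p - 1) (d : ℕ) (hτ : 0 ≤ τ) [Nonempty R]
    (u v : (Fin n → Bool) → R → Z) (S : Finset Z)
    (hu : ∀ z ∈ S, ((Finset.univ.filter fun q : (Fin n → Bool) × R => u q.1 q.2 = z).card : ℝ)
      ≤ τ * (2 ^ n * Fintype.card R))
    (hv : ∀ z ∈ S, ((Finset.univ.filter fun q : (Fin n → Bool) × R => v q.1 q.2 = z).card : ℝ)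
      ≤ τ * (2 ^ n * Fintype.card R)) :
    noiseWeight θ n d * ∑ z ∈ S, ((Finset.univ.filter fun q :
        ((Fin n → Bool) × (Fin n → Bool)) × (R × R) => hammingDist q.1.1 q.1.2 = d ∧
          u q.1.1 q.2.1 = z ∧ v q.1.2 q.2.2 = z).card : ℝ)
      ≤ 2 ^ n * (Fintype.card R : ℝ) ^ 2 * τ ^ (2 / p - 1) := by
  have hr : (0 : ℝ) < (Fintype.card R : ℝ) := by exact_mod_cast Fintype.card_pos
  have havg : ∀ (w : (Fin n → Bool) → R → Z) (z : Z),
      ((Finset.univ.filter fun q : (Fin n → Bool) × R => w q.1 q.2 = z).card : ℝ)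
        ≤ τ * (2 ^ n * Fintype.card R) → (∑ x, answerProb w z x) / 2 ^ n ≤ τ := by
    intro w z h
    rw [sum_answerProb, div_div, div_le_iff₀ (by positivity), mul_comm (Fintype.card R : ℝ)]
    exact h
  have hT : 0 ≤ τ ^ (2 / p - 1) := Real.rpow_nonneg hτ _
  simp only [card_agree_at_eq]
  calc _ = (Fintype.card R : ℝ) ^ 2 * ∑ z ∈ S, noiseWeight θ n d * ∑ x, ∑ y,
        (if hammingDist x y = d then answerProb u z x * answerProb v z y else 0) := by
        rw [← Finset.mul_sum, ← Finset.mul_sum]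
        ring
    _ ≤ (Fintype.card R : ℝ) ^ 2 * ∑ z ∈ S, τ ^ (2 / p - 1) *
        ((∑ x, answerProb u z x + ∑ x, answerProb v z x) / 2) := by
        refine mul_le_mul_of_nonneg_left (Finset.sum_le_sum fun z hz => ?_) (by positivity)
        exact sphere_form_le hp1 hp2 hθ0 hθ hρ d _ _ (answerProb_nonneg u z)
          (answerProb_nonneg v z) (answerProb_le_one u z) (answerProb_le_one v z)
          (havg u z (hu z hz)) (havg v z (hv z hz))
    _ = (Fintype.card R : ℝ) ^ 2 * (τ ^ (2 / p - 1) *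
        ((∑ z ∈ S, ∑ x, answerProb u z x + ∑ z ∈ S, ∑ x, answerProb v z x) / 2)) := by
        rw [← Finset.mul_sum, ← Finset.sum_div, Finset.sum_add_distrib]
    _ ≤ (Fintype.card R : ℝ) ^ 2 * (τ ^ (2 / p - 1) * ((2 ^ n + 2 ^ n) / 2)) := by
        have h1 := sum_sum_answerProb_le u S
        have h2 := sum_sum_answerProb_le v S
        refine mul_le_mul_of_nonneg_left (mul_le_mul_of_nonneg_left ?_ hT) (by positivity)
        linarith
    _ = _ := by ring

end AnswerProb

/-! ### Most pairs at a given distance are typical -/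

variable {U : Machine}

/-- The length of the binary notation of `n` is logarithmic. -/
lemma size_le_log {n : ℕ} (hn : 1 ≤ n) : (Nat.size n : ℝ) ≤ 2 * Real.log n + 1 := by
  have h1 : 2 ^ (Nat.size n - 1) ≤ n := by
    have hpos : 0 < Nat.size n := Nat.size_pos.2 hn
    exact Nat.lt_size.1 (by omega)
  have h2 : ((Nat.size n - 1 : ℕ) : ℝ) * Real.log 2 ≤ Real.log n := by
    rw [← Real.log_pow]
    exact Real.log_le_log (by positivity) (by exact_mod_cast h1)
  have h3 : ((Nat.size n : ℝ) - 1) ≤ ((Nat.size n - 1 : ℕ) : ℝ) := by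
    rw [sub_le_iff_le_add]
    exact_mod_cast (by omega : Nat.size n ≤ Nat.size n - 1 + 1)
  have h4 : 0 ≤ ((Nat.size n - 1 : ℕ) : ℝ) := Nat.cast_nonneg _
  nlinarith [Real.log_two_gt_d9]

lemma log_succ_le {n : ℕ} (hn : 1 ≤ n) : Real.log (n + 1 : ℝ) ≤ Real.log n + 1 := by
  have hn1 : (1 : ℝ) ≤ n := by exact_mod_cast hn
  calc Real.log (n + 1 : ℝ) ≤ Real.log (2 * n) := Real.log_le_log (by linarith) (by linarith)
    _ = Real.log 2 + Real.log n := Real.log_mul (by norm_num) (by linarith)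
    _ ≤ _ := by linarith [Real.log_two_lt_d9]

lemma one_le_log {n : ℕ} (hn : 3 ≤ n) : 1 ≤ Real.log (n : ℝ) := by
  rw [Real.le_log_iff_exp_le (by positivity)]
  have : (3 : ℝ) ≤ n := by exact_mod_cast hn
  linarith [Real.exp_one_lt_d9]

/-- Pairs at distance `d` with a component or a conditional complexity far below the typical
value. -/
def IsAtypical (U : Machine) (e : List Bool × List Bool ≃ List Bool) (k : ℕ) {n : ℕ}
    (x y : Fin n → Bool) : Prop :=
  complexity U (List.ofFn x) < n - 4 ∨ complexity U (List.ofFn y) < n - 4 ∨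
    condComplexity U (List.ofFn x) (List.ofFn y) < k - 5 ∨
    condComplexity U (List.ofFn y) (List.ofFn x) < k - 5 ∨
    pairComplexity U e (List.ofFn x) (List.ofFn y) < n + (k - 5)

open Classical in
/-- The pairs of strings of length `n` at distance `d` with the property `P`. -/
noncomputable def pairsAt {n : ℕ} (d : ℕ) (P : (Fin n → Bool) → (Fin n → Bool) → Prop) :
    Finset ((Fin n → Bool) × (Fin n → Bool)) :=
  Finset.univ.filter fun q => hammingDist q.1 q.2 = d ∧ P q.1 q.2

lemma mem_pairsAt {n d : ℕ} {P : (Fin n → Bool) → (Fin n → Bool) → Prop}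
    {q : (Fin n → Bool) × (Fin n → Bool)} :
    q ∈ pairsAt d P ↔ hammingDist q.1 q.2 = d ∧ P q.1 q.2 := by
  simp [pairsAt]

lemma card_pairsAt_swap {n d : ℕ} (P : (Fin n → Bool) → (Fin n → Bool) → Prop) :
    (pairsAt d fun x y => P y x).card = (pairsAt d P).card := by
  refine Finset.card_bij' (fun q _ => q.swap) (fun q _ => q.swap) ?_ ?_ (fun _ _ => rfl)
    (fun _ _ => rfl) <;>
  · intro q hq
    rw [mem_pairsAt] at hq ⊢
    rw [Prod.fst_swap, Prod.snd_swap, hammingDist_comm]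
    exact hq

lemma card_pairsAt_le_sum {n d : ℕ} (P : (Fin n → Bool) → (Fin n → Bool) → Prop) (b : ℕ)
    (h : ∀ y, ∃ s : Finset (Fin n → Bool), (∀ x, P x y → x ∈ s) ∧ s.card ≤ b) :
    (pairsAt d P).card ≤ 2 ^ n * b := by
  choose s hs hb using h
  calc (pairsAt d P).card
      ≤ ((Finset.univ : Finset (Fin n → Bool)).sigma fun y => s y).card := by
        refine Finset.card_le_card_of_injOn (fun q => ⟨q.2, q.1⟩) ?_ ?_
        · intro q hq
          exact Finset.mem_sigma.2 ⟨Finset.mem_univ _, hs _ _ (mem_pairsAt.1 hq).2⟩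
        · rintro ⟨x, y⟩ _ ⟨x', y'⟩ _ h
          simp only [Sigma.mk.injEq, heq_eq_eq] at h
          rw [h.1, h.2]
    _ = ∑ y, (s y).card := Finset.card_sigma _ _
    _ ≤ ∑ _y : Fin n → Bool, b := Finset.sum_le_sum fun y _ => hb y
    _ = _ := by simp

lemma card_pairsAt_snd_le {n d b : ℕ} (P : (Fin n → Bool) → Prop) (s : Finset (Fin n → Bool))
    (hs : ∀ y, P y → y ∈ s) (hb : s.card ≤ b) :
    (pairsAt d fun _ y => P y).card ≤ b * n.choose d := by
  calc (pairsAt d fun _ y => P y).card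
      ≤ (s.sigma fun y => Finset.univ.filter fun x : Fin n → Bool => hammingDist x y = d).card := by
        refine Finset.card_le_card_of_injOn (fun q => ⟨q.2, q.1⟩) ?_ ?_
        · intro q hq
          have hq := mem_pairsAt.1 hq
          exact Finset.mem_sigma.2 ⟨hs _ hq.2, Finset.mem_filter.2 ⟨Finset.mem_univ _, hq.1⟩⟩
        · rintro ⟨x, y⟩ _ ⟨x', y'⟩ _ h
          simp only [Sigma.mk.injEq, heq_eq_eq] at h
          rw [h.1, h.2]
    _ = s.card * n.choose d := by
        rw [Finset.card_sigma]
        simp_rw [card_sphere]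
        simp
    _ ≤ _ := Nat.mul_le_mul_right _ hb

/-- Each of the five defects affects at most a `1 / 16` share of the pairs, by counting strings of
low complexity. The conditional and pair thresholds use `k - 5` rather than `k - 4` because `k` is a
rounded-up logarithm: only `2 ^ (k - 1) < n.choose d` is available. -/
lemma IsOptimal.card_atypical_le (hU : IsOptimal U) (e : List Bool × List Bool ≃ List Bool)
    {n d k : ℕ} (hn : 4 ≤ n) (hkd : k = Nat.clog 2 (n.choose d)) (hk : 5 ≤ k) :
    16 * (pairsAt (n := n) d (IsAtypical U e k)).card ≤ 5 * (2 ^ n * n.choose d) := by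
  set B := n.choose d with hB
  have hinj : Function.Injective (List.ofFn : (Fin n → Bool) → List Bool) := List.ofFn_injective
  have hkB : 16 * 2 ^ (k - 5) ≤ B := by
    have h1 : 1 < B := by
      by_contra h
      have : k = 0 := hkd.trans (Nat.clog_of_right_le_one (by omega) 2)
      omega
    have h2 := Nat.pow_pred_clog_lt_self (b := 2) (by norm_num) h1
    rw [← hkd] at h2
    have h3 : 16 * 2 ^ (k - 5) = 2 ^ (k - 1) := by
      rw [show k - 1 = 4 + (k - 5) by omega, pow_add]
      norm_num
    rw [h3]
    exact h2.le
  have hn4 : 16 * 2 ^ (n - 4) = 2 ^ n := by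
    conv_rhs => rw [show n = 4 + (n - 4) by omega, pow_add]
    norm_num
  have h1 : 16 * (pairsAt (n := n) d fun _ y => complexity U (List.ofFn y) < n - 4).card ≤
      2 ^ n * B := by
    calc _ ≤ 16 * (2 ^ (n - 4) * B) := Nat.mul_le_mul_left _ (card_pairsAt_snd_le _ _
            (fun y hy => Finset.mem_filter.2 ⟨Finset.mem_univ y, hy⟩)
            (hU.card_filter_le _ hinj [] _))
      _ = _ := by rw [← mul_assoc, hn4]
  have h2 : 16 * (pairsAt (n := n) d fun x _ => complexity U (List.ofFn x) < n - 4).card ≤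
      2 ^ n * B := by
    rw [card_pairsAt_swap fun _ x => complexity U (List.ofFn x) < n - 4]
    exact h1
  have h3 : 16 * (pairsAt (n := n) d fun x y =>
      condComplexity U (List.ofFn x) (List.ofFn y) < k - 5).card ≤ 2 ^ n * B := by
    calc _ ≤ 16 * (2 ^ n * 2 ^ (k - 5)) := Nat.mul_le_mul_left _ (card_pairsAt_le_sum _ _
            fun y => ⟨_, fun x hx => Finset.mem_filter.2 ⟨Finset.mem_univ x, hx⟩,
              hU.card_filter_le _ hinj _ _⟩)
      _ = 2 ^ n * (16 * 2 ^ (k - 5)) := by ring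
      _ ≤ _ := Nat.mul_le_mul_left _ hkB
  have h4 : 16 * (pairsAt (n := n) d fun x y =>
      condComplexity U (List.ofFn y) (List.ofFn x) < k - 5).card ≤ 2 ^ n * B := by
    rw [card_pairsAt_swap fun y x => condComplexity U (List.ofFn y) (List.ofFn x) < k - 5]
    exact h3
  have h5 : 16 * (pairsAt (n := n) d fun x y =>
      pairComplexity U e (List.ofFn x) (List.ofFn y) < n + (k - 5)).card ≤ 2 ^ n * B := by
    have : (pairsAt (n := n) d fun x y => pairComplexity U e (List.ofFn x) (List.ofFn y) <
        n + (k - 5)).card ≤ 2 ^ (n + (k - 5)) := by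
      refine le_trans (Finset.card_le_card ?_) (hU.card_filter_le
        (fun q : (Fin n → Bool) × (Fin n → Bool) => e (List.ofFn q.1, List.ofFn q.2)) ?_ []
        (n + (k - 5)))
      · intro q hq
        exact Finset.mem_filter.2 ⟨Finset.mem_univ _, (mem_pairsAt.1 hq).2⟩
      · intro q q' hqq
        have := e.injective hqq
        rw [Prod.mk.injEq] at this
        exact Prod.ext (hinj this.1) (hinj this.2)
    calc _ ≤ 16 * 2 ^ (n + (k - 5)) := Nat.mul_le_mul_left _ this
      _ = 2 ^ n * (16 * 2 ^ (k - 5)) := by rw [pow_add]; ring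
      _ ≤ _ := Nat.mul_le_mul_left _ hkB
  generalize hS1 : (pairsAt (n := n) d fun _ y => complexity U (List.ofFn y) < n - 4) = S1 at h1
  generalize hS2 : (pairsAt (n := n) d fun x _ => complexity U (List.ofFn x) < n - 4) = S2 at h2
  generalize hS3 : (pairsAt (n := n) d fun x y =>
      condComplexity U (List.ofFn x) (List.ofFn y) < k - 5) = S3 at h3
  generalize hS4 : (pairsAt (n := n) d fun x y =>
      condComplexity U (List.ofFn y) (List.ofFn x) < k - 5) = S4 at h4
  generalize hS5 : (pairsAt (n := n) d fun x y =>
      pairComplexity U e (List.ofFn x) (List.ofFn y) < n + (k - 5)) = S5 at h5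
  have hsub : pairsAt d (IsAtypical U e k) ⊆ S1 ∪ (S2 ∪ (S3 ∪ (S4 ∪ S5))) := by
    intro q hq
    simp only [← hS1, ← hS2, ← hS3, ← hS4, ← hS5, IsAtypical, mem_pairsAt,
      Finset.mem_union] at hq ⊢
    tauto
  have hu1 := (Finset.card_le_card hsub).trans (Finset.card_union_le _ _)
  have hu2 := Finset.card_union_le S2 (S3 ∪ (S4 ∪ S5))
  have hu3 := Finset.card_union_le S3 (S4 ∪ S5)
  have hu4 := Finset.card_union_le S4 S5
  omega

open Classical in
/-- At least half of the pairs of strings at distance `d ≈ θ n` have the complexity profile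
required of the inputs. -/
lemma IsOptimal.exists_half_isHammingPair (hU : IsOptimal U)
    {e : List Bool × List Bool ≃ List Bool} (he : e.Computable) {θ : ℝ} (hθ0 : 0 < θ)
    (hθ : θ < 1 / 2) (hent : Real.binEntropy θ / Real.log 2 = 1 / 2) :
    ∃ D₀ : ℝ, ∃ N : ℕ, ∀ D : ℝ, D₀ ≤ D → ∀ n d : ℕ, N ≤ n → |(d : ℝ) - θ * n| < 1 →
      2 ^ n * n.choose d ≤ 2 * (Finset.univ.filter fun q : (Fin n → Bool) × (Fin n → Bool) =>
        IsHammingPair U e D d n q.1 q.2).card := by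
  obtain ⟨c₀, hc₀, hclog⟩ := exists_clog_choose_near hθ0 hθ hent
  obtain ⟨c₁, h₁⟩ := hU.condComplexity_le_length
  obtain ⟨c₂, h₂⟩ := hU.condComplexity_le_of_dist
  obtain ⟨c₃, h₃⟩ := hU.pairComplexity_le_of_dist he
  -- Ensures `k ≥ 5`, so that `k - 5` is not truncated.
  have hlarge : ∃ N : ℕ, ∀ n : ℕ, N ≤ n → 5 ≤ (n : ℝ) / 2 - c₀ - 2 * Real.log (n + 1) := by
    have ht : Filter.Tendsto (fun n : ℕ => (n : ℝ) + 1) Filter.atTop Filter.atTop :=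
      Filter.tendsto_atTop_add_const_right _ _ tendsto_natCast_atTop_atTop
    have h1 := (Real.isLittleO_log_id_atTop.comp_tendsto ht).bound
      (show (0 : ℝ) < 1 / 8 by norm_num)
    obtain ⟨N₁, hN₁⟩ := Filter.eventually_atTop.1 h1
    obtain ⟨N₂, hN₂⟩ := exists_nat_ge (4 * (c₀ + 6))
    refine ⟨max N₁ N₂, fun n hn => ?_⟩
    have h2 := hN₁ n (le_of_max_le_left hn)
    have h3 : (N₂ : ℝ) ≤ n := by exact_mod_cast le_of_max_le_right hn
    have hn0 : (0 : ℝ) ≤ n := Nat.cast_nonneg n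
    simp only [Function.comp_apply, id, Real.norm_eq_abs] at h2
    rw [abs_of_nonneg (show (0 : ℝ) ≤ n + 1 by linarith)] at h2
    have h4 := le_abs_self (Real.log ((n : ℝ) + 1))
    linarith
  obtain ⟨N₀, hN₀⟩ := hlarge
  refine ⟨c₀ + 2 * c₁ + c₂ + c₃ + 40, max N₀ 5, fun D hD n d hn hd => ?_⟩
  have hn5 : 5 ≤ n := le_of_max_le_right hn
  have hn1 : 1 ≤ n := by omega
  have hk := hclog n d hn1 hd
  have hdn := le_of_near_mul hθ hn1 hd
  have hlg := log_succ_le hn1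
  have hl1 := one_le_log (n := n) (by omega)
  have hsz := size_le_log hn1
  have hkN := hN₀ n (le_of_max_le_left hn)
  set k := Nat.clog 2 (n.choose d) with hkdef
  have hk5 : 5 ≤ k := by
    have : (5 : ℝ) ≤ k := hkN.trans hk.2
    exact_mod_cast this
  set l := Nat.size n with hl
  have hnl : n < 2 ^ l := Nat.lt_size_self n
  have hbad := hU.card_atypical_le e (n := n) (d := d) (by omega) hkdef hk5
  have hall := card_pairs_at_distance n d
  have hsub : (Finset.univ.filter fun q : (Fin n → Bool) × (Fin n → Bool) =>
      hammingDist q.1 q.2 = d) ⊆ (Finset.univ.filter fun q : (Fin n → Bool) × (Fin n → Bool) =>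
        IsHammingPair U e D d n q.1 q.2) ∪
      pairsAt d (IsAtypical U e k) := by
    rintro ⟨x, y⟩ hq
    simp only [Finset.mem_filter, Finset.mem_univ, true_and, Finset.mem_union, mem_pairsAt] at hq ⊢
    by_cases hat : IsAtypical U e k x y
    · exact Or.inr ⟨hq, hat⟩
    left
    simp only [IsAtypical, not_or, not_lt] at hat
    obtain ⟨a1, a2, a3, a4, a5⟩ := hat
    -- Upper bounds on the complexities come from explicit descriptions, lower bounds from the pair
    -- not being atypical.
    have b1 := h₁ (List.ofFn x) []
    have b2 := h₁ (List.ofFn y) []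
    have b3 := h₂ n d l x y hq (hdn.trans_lt hnl)
    have b4 := h₂ n d l y x (by rw [hammingDist_comm]; exact hq) (hdn.trans_lt hnl)
    have b5 := h₃ n d l x y hq hnl (hdn.trans_lt hnl)
    rw [List.length_ofFn] at b1 b2
    rw [← hkdef] at b3 b4 b5
    change complexity U (List.ofFn x) ≤ _ at b1
    change complexity U (List.ofFn y) ≤ _ at b2
    have a1' : n ≤ complexity U (List.ofFn x) + 4 := by omega
    have a2' : n ≤ complexity U (List.ofFn y) + 4 := by omega
    have a3' : k ≤ condComplexity U (List.ofFn x) (List.ofFn y) + 5 := by omega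
    have a4' : k ≤ condComplexity U (List.ofFn y) (List.ofFn x) + 5 := by omega
    have a5' : n + k ≤ pairComplexity U e (List.ofFn x) (List.ofFn y) + 5 := by omega
    rify at a1' a2' a3' a4' a5' b1 b2 b3 b4 b5
    have hDl : (c₀ + 2 * c₁ + c₂ + c₃ + 40) * Real.log n ≤ D * Real.log n := by gcongr
    have hm : ∀ c : ℝ, 0 ≤ c → c ≤ c * Real.log n := fun c hc => le_mul_of_one_le_right hc hl1
    have m0 := hm c₀ hc₀
    have m1 := hm c₁ (Nat.cast_nonneg _)
    have m2 := hm c₂ (Nat.cast_nonneg _)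
    have m3 := hm c₃ (Nat.cast_nonneg _)
    have p1 : (0 : ℝ) ≤ c₁ := Nat.cast_nonneg _
    have p2 : (0 : ℝ) ≤ c₂ := Nat.cast_nonneg _
    have p3 : (0 : ℝ) ≤ c₃ := Nat.cast_nonneg _
    obtain ⟨k1, k2⟩ := hk
    refine ⟨hq, ?_, ?_, ?_⟩
    · rw [mutualInfo, abs_le]
      push_cast
      constructor <;> linarith
    · rw [abs_le]
      constructor <;> linarith
    · rw [abs_le]
      constructor <;> linarith
  -- The atypical share is at most `5 / 16`, which is below one half.
  have := (Finset.card_le_card hsub).trans (Finset.card_union_le _ _)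
  rw [hall] at this
  omega

/-! ### The lower bound -/

lemma exists_forall_log_lt (C₁ C₂ : ℝ) {ε : ℝ} (hε : 0 < ε) :
    ∃ N : ℕ, ∀ n : ℕ, N ≤ n → C₁ * Real.log n + C₂ < ε * n := by
  have h1 := ((Real.isLittleO_log_id_atTop.const_mul_left C₁).comp_tendsto
    (tendsto_natCast_atTop_atTop (R := ℝ))).bound (show (0 : ℝ) < ε / 2 by positivity)
  obtain ⟨N₁, hN₁⟩ := Filter.eventually_atTop.1 h1
  obtain ⟨N₂, hN₂⟩ := exists_nat_gt (2 * C₂ / ε)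
  refine ⟨max N₁ N₂, fun n hn => ?_⟩
  have h2 := hN₁ n (le_of_max_le_left hn)
  have h3 : (N₂ : ℝ) ≤ n := by exact_mod_cast le_of_max_le_right hn
  have hn0 : (0 : ℝ) ≤ n := Nat.cast_nonneg n
  simp only [Function.comp_apply, id, Real.norm_eq_abs, abs_of_nonneg hn0] at h2
  have h4 := le_abs_self (C₁ * Real.log n)
  have h5 : 2 * C₂ < n * ε := by
    rw [← div_lt_iff₀ hε]
    linarith
  linarith

/-- If the parties agree on an unlikely answer given some hint from a finite set, then the set of
hints is large. -/
lemma card_agree_with_hint_le {outA outB : Profile × List Bool × List Bool × List Bool → List Bool} {p θ : ℝ} (hp1 : 1 ≤ p) (hp2 : p ≤ 2) (hθ0 : 0 < θ)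
    (hθ : θ < 1 / 2) (hρ : 1 - 2 * θ ≤ p - 1) {n m d s : ℕ} (A : Finset Profile)
    (T : Finset (List Bool))
    (Ω : Finset (((Fin n → Bool) × (Fin n → Bool)) ×
      ((Fin (m) → Bool) × (Fin (m) → Bool))))
    (hΩ : ∀ q ∈ Ω, hammingDist q.1.1 q.1.2 = d ∧ ∃ a ∈ A, ∃ t ∈ T, ∃ z,
      outA (a, List.ofFn q.1.1, List.ofFn q.2.1, t) = z ∧
      outB (a, List.ofFn q.1.2, List.ofFn q.2.2, t) = z ∧
      2 ^ s * answerCount outA n (m) a t z ≤ 2 ^ (n + m) ∧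
      2 ^ s * answerCount outB n (m) a t z ≤ 2 ^ (n + m)) :
    noiseWeight θ n d * (Ω.card : ℝ) ≤ A.card * T.card *
      (2 ^ n * (2 ^ m) ^ 2 * ((1 / 2) ^ s) ^ (2 / p - 1)) := by
  -- With the hint fixed, each answer is a function of the party's own input and random bits. The
  -- way in which the transcript arose plays no role.
  let u : Profile × List Bool → (Fin n → Bool) → (Fin m → Bool) → List Bool :=
    fun b x r => outA (b.1, List.ofFn x, List.ofFn r, b.2)
  let v : Profile × List Bool → (Fin n → Bool) → (Fin m → Bool) → List Bool :=
    fun b x r => outB (b.1, List.ofFn x, List.ofFn r, b.2)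
  let S : Profile × List Bool → Finset (List Bool) := fun b =>
    (Finset.univ.image fun q : (Fin n → Bool) × (Fin m → Bool) => u b q.1 q.2).filter fun z =>
      2 ^ s * answerCount outA n m b.1 b.2 z ≤ 2 ^ (n + m) ∧
      2 ^ s * answerCount outB n m b.1 b.2 z ≤ 2 ^ (n + m)
  let P : Profile × List Bool → List Bool → Finset (((Fin n → Bool) × (Fin n → Bool)) ×
      ((Fin m → Bool) × (Fin m → Bool))) := fun b z => Finset.univ.filter fun q =>
    hammingDist q.1.1 q.1.2 = d ∧ u b q.1.1 q.2.1 = z ∧ v b q.1.2 q.2.2 = z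
  have hsub : Ω ⊆ (A ×ˢ T).biUnion fun b => (S b).biUnion fun z => P b z := by
    intro q hq
    obtain ⟨hd, a, ha, t, ht, z, h1, h2, h3, h4⟩ := hΩ q hq
    refine Finset.mem_biUnion.2 ⟨(a, t), Finset.mem_product.2 ⟨ha, ht⟩,
      Finset.mem_biUnion.2 ⟨z, Finset.mem_filter.2 ⟨?_, h3, h4⟩,
        Finset.mem_filter.2 ⟨Finset.mem_univ _, hd, h1, h2⟩⟩⟩
    exact Finset.mem_image.2 ⟨(q.1.1, q.2.1), Finset.mem_univ _, h1⟩
  have hcard : (Ω.card : ℝ) ≤ ∑ b ∈ A ×ˢ T, ∑ z ∈ S b, ((P b z).card : ℝ) := by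
    have : Ω.card ≤ ∑ b ∈ A ×ˢ T, ∑ z ∈ S b, (P b z).card :=
      (Finset.card_le_card hsub).trans (Finset.card_biUnion_le.trans
        (Finset.sum_le_sum fun b _ => Finset.card_biUnion_le))
    exact_mod_cast this
  have hlight : ∀ k : ℕ, 2 ^ s * k ≤ 2 ^ (n + m) →
      (k : ℝ) ≤ (1 / 2) ^ s * (2 ^ n * (Fintype.card (Fin m → Bool) : ℝ)) := by
    intro k hk
    have hk' : (2 : ℝ) ^ s * k ≤ 2 ^ (n + m) := by exact_mod_cast hk
    have h2 : (1 / 2 : ℝ) ^ s * 2 ^ s = 1 := by rw [← mul_pow]; norm_num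
    calc (k : ℝ) = (1 / 2) ^ s * (2 ^ s * k) := by rw [← mul_assoc, h2, one_mul]
      _ ≤ (1 / 2) ^ s * 2 ^ (n + m) := by gcongr
      _ = _ := by simp [pow_add]
  have hw := noiseWeight_pos hθ0 (by linarith) n d
  have hR : (Fintype.card (Fin m → Bool) : ℝ) = 2 ^ m := by simp
  calc noiseWeight θ n d * (Ω.card : ℝ)
      ≤ noiseWeight θ n d * ∑ b ∈ A ×ˢ T, ∑ z ∈ S b, ((P b z).card : ℝ) := by gcongr
    _ = ∑ b ∈ A ×ˢ T, noiseWeight θ n d * ∑ z ∈ S b, ((P b z).card : ℝ) := Finset.mul_sum _ _ _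
    _ ≤ ∑ _b ∈ A ×ˢ T, (2 ^ n * (2 ^ m) ^ 2 * ((1 / 2 : ℝ) ^ s) ^ (2 / p - 1)) := by
        refine Finset.sum_le_sum fun b _ => ?_
        rw [← hR]
        exact card_agree_le hp1 hp2 hθ0.le hθ.le hρ d (by positivity) (u b) (v b) (S b)
          (fun z hz => hlight _ (Finset.mem_filter.1 hz).2.1)
          (fun z hz => hlight _ (Finset.mem_filter.1 hz).2.2)
    _ = _ := by rw [Finset.sum_const, Finset.card_product, nsmul_eq_mul]; push_cast; rfl

/-- Each of the four nested pairings doubles the number of bits, hence `2 ^ 4 = 16`. -/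
lemma encode_profile_lt {n s b : ℕ} {a : Profile} (hn : n < 2 ^ b) (hs : s < 2 ^ b)
    (h1 : a.1 < 2 ^ b) (h2 : a.2.1 < 2 ^ b) (h3 : a.2.2 < 2 ^ b) :
    Encodable.encode (n, a, s) < 2 ^ (16 * b) := by
  obtain ⟨a₁, a₂, a₃⟩ := a
  simp only [Encodable.encode_prod_val, Encodable.encode_nat] at h1 h2 h3 ⊢
  have hb : ∀ {c k : ℕ}, c < 2 ^ b → b ≤ k → c < 2 ^ k := fun hc hk =>
    hc.trans_le (Nat.pow_le_pow_right (by norm_num) hk)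
  have e1 := pair_lt_two_pow h2 h3
  have e2 := pair_lt_two_pow (hb h1 (by omega)) e1
  have e3 := pair_lt_two_pow e2 (hb hs (by omega))
  have e4 := pair_lt_two_pow (hb hn (by omega)) e3
  exact e4.trans_le (Nat.pow_le_pow_right (by norm_num) (by omega))

variable {U : Machine} {e : List Bool × List Bool ≃ List Bool}

/-- Both parties give with small probability, over their inputs and random bits, an answer that
is a secret key for the given transcript. -/
lemma IsOptimal.answerCount_le_of_agree (hU : IsOptimal U) (π : Protocol) :
    ∃ c : ℕ, ∀ (n s b : ℕ) (K δ : ℝ) (x y : Fin n → Bool)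
      (r : (Fin (π.randLen n) → Bool) × (Fin (π.randLen n) → Bool)),
      π.Agree U e K (δ * n) x y r → n < 2 ^ b → s < 2 ^ b →
      complexity U (List.ofFn x) < 2 ^ b → complexity U (List.ofFn y) < 2 ^ b →
      pairComplexity U e (List.ofFn x) (List.ofFn y) < 2 ^ b →
      (s : ℝ) + 32 * b + c < δ * n - K * Real.log n →
      let a := profile U e (List.ofFn x) (List.ofFn y)
      let t := π.transcript a x y r.1 r.2
      let z := π.keyAlice a x y r.1 r.2
      2 ^ s * answerCount π.outAlice n (π.randLen n) a t z ≤ 2 ^ (n + π.randLen n) ∧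
      2 ^ s * answerCount π.outBob n (π.randLen n) a t z ≤ 2 ^ (n + π.randLen n) := by
  obtain ⟨c₁, h₁⟩ := hU.condComplexity_le_of_answerCount π.computable_outAlice
    π.computable_randLen
  obtain ⟨c₂, h₂⟩ := hU.condComplexity_le_of_answerCount π.computable_outBob
    π.computable_randLen
  refine ⟨c₁ + c₂, fun n s b K δ x y r hag hn hs hx hy hxy hlt => ?_⟩
  obtain ⟨-, hz1, hz2⟩ := hag
  have henc := encode_profile_lt (a := profile U e (List.ofFn x) (List.ofFn y)) hn hs hx hy hxy
  push_cast at hlt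
  have p1 : (0 : ℝ) ≤ c₁ := Nat.cast_nonneg _
  have p2 : (0 : ℝ) ≤ c₂ := Nat.cast_nonneg _
  -- A heavier answer would have complexity at most `s + 32 b` plus a constant, less than secrecy
  -- demands.
  refine ⟨?_, ?_⟩ <;> by_contra hcon
  · have := h₁ n _ s _ _ _ (not_le.1 hcon).le henc
    rify at this
    linarith
  · have := h₂ n _ s _ _ _ (not_le.1 hcon).le henc
    rify at this
    linarith

/-- A crude linear bound is enough: it leaves `(8n)^3` possible profiles, a factor that is only
logarithmic in the exponent. -/
lemma IsOptimal.exists_profile_lt (hU : IsOptimal U) (he : e.Computable) :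
    ∃ N : ℕ, ∀ (n : ℕ) (x y : Fin n → Bool), N ≤ n →
      complexity U (List.ofFn x) < 8 * n ∧ complexity U (List.ofFn y) < 8 * n ∧
      pairComplexity U e (List.ofFn x) (List.ofFn y) < 8 * n := by
  obtain ⟨c₁, h₁⟩ := hU.condComplexity_le_length
  obtain ⟨c₃, h₃⟩ := hU.pairComplexity_le_of_dist he
  refine ⟨c₁ + c₃ + 1, fun n x y hn => ?_⟩
  have b1 := h₁ (List.ofFn x) []
  have b2 := h₁ (List.ofFn y) []
  rw [List.length_ofFn] at b1 b2
  change complexity U (List.ofFn x) ≤ _ at b1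
  change complexity U (List.ofFn y) ≤ _ at b2
  have hdn : hammingDist x y ≤ n := by
    simpa using hammingDist_le_card_fintype (x := x) (y := y)
  have hn2 : n < 2 ^ n := Nat.lt_two_pow_self
  have b3 := h₃ n _ n x y rfl hn2 (hdn.trans_lt hn2)
  have b4 : Nat.clog 2 (n.choose (hammingDist x y)) ≤ n :=
    Nat.clog_le_of_le_pow (Nat.choose_le_two_pow _ _)
  omega

open Classical in
lemma agree_card_ge (π : Protocol) {K s D : ℝ} {d n : ℕ}
    (h : ∀ x y : Fin n → Bool, IsHammingPair U e D d n x y → 0.99 < π.agreeProb U e K s x y) :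
    0.99 * (2 ^ π.randLen n) ^ 2 * ((Finset.univ.filter fun q : (Fin n → Bool) × (Fin n → Bool) =>
        IsHammingPair U e D d n q.1 q.2).card : ℝ) ≤
      ((Finset.univ.filter fun q : ((Fin n → Bool) × (Fin n → Bool)) ×
        ((Fin (π.randLen n) → Bool) × (Fin (π.randLen n) → Bool)) =>
        IsHammingPair U e D d n q.1.1 q.1.2 ∧ π.Agree U e K s q.1.1 q.1.2 q.2).card : ℝ) := by
  have hN : (Finset.univ.filter fun q : ((Fin n → Bool) × (Fin n → Bool)) ×
        ((Fin (π.randLen n) → Bool) × (Fin (π.randLen n) → Bool)) =>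
        IsHammingPair U e D d n q.1.1 q.1.2 ∧ π.Agree U e K s q.1.1 q.1.2 q.2).card =
      ∑ q ∈ Finset.univ.filter fun q : (Fin n → Bool) × (Fin n → Bool) =>
        IsHammingPair U e D d n q.1 q.2,
        (Finset.univ.filter fun r => π.Agree U e K s q.1 q.2 r).card := by
    rw [Finset.card_filter, Fintype.sum_prod_type, Finset.sum_filter]
    refine Finset.sum_congr rfl fun q _ => ?_
    rw [Finset.card_filter]
    by_cases hq : IsHammingPair U e D d n q.1 q.2
    · rw [if_pos hq]
      refine Finset.sum_congr rfl fun r _ => ?_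
      by_cases hr : π.Agree U e K s q.1 q.2 r
      · rw [if_pos ⟨hq, hr⟩, if_pos hr]
      · rw [if_neg fun h => hr h.2, if_neg hr]
    · simp [hq]
  rw [hN]
  push_cast
  rw [mul_comm, ← nsmul_eq_mul, ← Finset.sum_const]
  refine Finset.sum_le_sum fun q hq => ?_
  have hq := h q.1 q.2 (Finset.mem_filter.1 hq).2
  rw [Protocol.agreeProb, Nat.card_eq_fintype_card, Nat.card_eq_fintype_card,
    Fintype.card_subtype, Fintype.card_prod, lt_div_iff₀ (by
      have : 0 < Fintype.card (Fin (π.randLen n) → Bool) := Fintype.card_pos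
      positivity)] at hq
  refine le_trans (le_of_eq ?_) hq.le
  simp [pow_two]

end SecretKey

theorem mainTheorem5 (θ : ℝ) (hθ : θ ∈ Set.Ioo (0 : ℝ) (1 / 2))
    (hent : Real.binEntropy θ / Real.log 2 = 1 / 2) :
    ∃ c : ℝ, 0 < c ∧
      ∀ (U : SecretKey.Machine), SecretKey.IsOptimal U →
      ∀ (e : List Bool × List Bool ≃ List Bool), e.Computable →
      ∃ D₀ : ℝ, ∀ D : ℝ, D₀ ≤ D →
      ∀ δ : ℝ, δ ∈ Set.Ioo (0 : ℝ) 1 →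
      ∀ (K : ℝ) (π : SecretKey.Protocol),
      ∃ N : ℕ, ∀ n : ℕ, N ≤ n →
      ∀ d : ℕ, |(d : ℝ) - θ * n| < 1 →
        (∀ x y : Fin n → Bool, SecretKey.IsHammingPair U e D d n x y →
          0.99 < π.agreeProb U e K (δ * n) x y) →
        c * (δ * n) ≤ (π.commComplexity U e n : ℝ) := by
  classical
  obtain ⟨hθ0, hθ1⟩ := hθ
  -- Here `p = 2 - 2θ` is the smallest exponent with `1 - 2θ ≤ p - 1`, and `γ = 2 / p - 1 = θ / (1 -
  -- θ)`.
  set γ : ℝ := 2 / (2 - 2 * θ) - 1 with hγdef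
  have hγ : 0 < γ := by
    rw [hγdef, sub_pos, lt_div_iff₀ (by linarith)]
    linarith
  -- Half of the exponent `γ` is given up to absorb the logarithmic terms.
  refine ⟨γ / 2, by positivity, fun U hU e he => ?_⟩
  obtain ⟨D₀, N₀, hhalf⟩ := hU.exists_half_isHammingPair he hθ0 hθ1 hent
  refine ⟨D₀, fun D hD δ hδ K π => ?_⟩
  obtain ⟨hδ0, hδ1⟩ := hδ
  obtain ⟨N₁, hprof⟩ := hU.exists_profile_lt he
  obtain ⟨c₀, hlight⟩ := hU.answerCount_le_of_agree (e := e) π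
  set E : ℝ := 1 / (θ * (1 - θ)) with hE
  have hl2 : 0 < Real.log 2 := Real.log_pos (by norm_num)
  obtain ⟨N₂, hN₂⟩ := SecretKey.exists_forall_log_lt (|K| + 64) (130 + c₀) hδ0
  obtain ⟨N₃, hN₃⟩ := SecretKey.exists_forall_log_lt (4 + γ * Real.log 2 * (|K| + 64))
    (3 * Real.log 8 + Real.log 2 + 1 + E + 1 + γ * Real.log 2 * (130 + c₀))
    (show 0 < γ * Real.log 2 * δ / 2 by positivity)
  refine ⟨max (max N₀ N₁) (max N₂ (max N₃ 3)), fun n hn d hd hagree => ?_⟩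
  simp only [max_le_iff] at hn
  obtain ⟨⟨hn0, hn1⟩, hn2, hn3, hn4⟩ := hn
  by_contra! hcomm
  set ℓ := π.commComplexity U e n with hℓ
  set m := π.randLen n with hm
  have hn1' : 1 ≤ n := by omega
  have hlog1 := SecretKey.one_le_log hn4
  have hsize := SecretKey.size_le_log hn1'
  have hnpos : (0 : ℝ) < n := by exact_mod_cast hn1'
  set l := Nat.size n with hl
  have hnl : n < 2 ^ l := Nat.lt_size_self n
  have hnb : 8 * n < 2 ^ (l + 3) := by rw [pow_add]; omega
  have hKabs := mul_le_mul_of_nonneg_right (le_abs_self K) (by linarith : 0 ≤ Real.log (n : ℝ))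
  have hKnn : 0 ≤ |K| * Real.log n := mul_nonneg (abs_nonneg K) (by linarith)
  -- The largest `s` for which heavy answers contradict secrecy, up to a margin of one for
  -- strictness. Profiles lie below `8n < 2 ^ (l + 3)`, hence `32 (l + 3)`. With `|K|` in place of
  -- `K` also `s ≤ n` holds for negative `K`.
  set X : ℝ := δ * n - |K| * Real.log n - 32 * (l + 3) - c₀ - 1 with hX
  have hX0 : 0 ≤ X := by
    have := hN₂ n hn2
    rw [hX]
    linarith
  set s := ⌊X⌋₊ with hs
  have hsX : (s : ℝ) ≤ X := Nat.floor_le hX0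
  have hXs : X < s + 1 := Nat.lt_floor_add_one X
  have hsn : s ≤ n := by
    have h1 : X ≤ n := by
      have : δ * n ≤ n := mul_le_of_le_one_left hnpos.le hδ1.le
      have : (0 : ℝ) ≤ l := Nat.cast_nonneg _
      have : (0 : ℝ) ≤ c₀ := Nat.cast_nonneg _
      rw [hX]
      linarith
    exact_mod_cast hsX.trans h1
  set Ω := Finset.univ.filter fun q : ((Fin n → Bool) × (Fin n → Bool)) ×
      ((Fin m → Bool) × (Fin m → Bool)) =>
    SecretKey.IsHammingPair U e D d n q.1.1 q.1.2 ∧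
      π.Agree U e K (δ * n) q.1.1 q.1.2 q.2 with hΩ
  have hupper := SecretKey.card_agree_with_hint_le (outA := π.outAlice) (outB := π.outBob)
    (p := 2 - 2 * θ) (θ := θ) (by linarith) (by linarith) hθ0 hθ1 (by linarith)
    (n := n) (m := m) (d := d) (s := s)
    (Finset.range (8 * n) ×ˢ (Finset.range (8 * n) ×ˢ Finset.range (8 * n)))
    (SecretKey.shortStrings (ℓ + 1)) Ω (by
      rintro ⟨⟨x, y⟩, r⟩ hq
      obtain ⟨hpair, hag⟩ := (Finset.mem_filter.1 hq).2
      obtain ⟨q1, q2, q3⟩ := hprof n x y hn1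
      have hlt := hlight n s (l + 3) K δ x y r hag (by omega) (by omega) (q1.trans hnb)
        (q2.trans hnb) (q3.trans hnb) (by
          push_cast
          linarith)
      refine ⟨hpair.dist_eq, SecretKey.profile U e (List.ofFn x) (List.ofFn y), ?_,
        π.transcript (SecretKey.profile U e (List.ofFn x) (List.ofFn y)) x y r.1 r.2, ?_,
        π.keyAlice (SecretKey.profile U e (List.ofFn x) (List.ofFn y)) x y r.1 r.2, rfl,
        hag.1.symm, hlt⟩
      · simp only [Finset.mem_product, Finset.mem_range]
        exact ⟨q1, q2, q3⟩
      · rw [SecretKey.mem_shortStrings, Nat.lt_succ_iff]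
        exact Finset.le_sup (f := fun v : (Fin n → Bool) × (Fin n → Bool) ×
          (Fin (π.randLen n) → Bool) × (Fin (π.randLen n) → Bool) =>
            (π.transcript (SecretKey.profile U e (List.ofFn v.1) (List.ofFn v.2.1))
              v.1 v.2.1 v.2.2.1 v.2.2.2).length) (Finset.mem_univ (x, y, r.1, r.2)))
  have hlower := SecretKey.agree_card_ge π hagree
  have hgood := hhalf D hD n d hn0 hd
  have hbin := SecretKey.exp_neg_le_choose_mul_noiseWeight hθ0 hθ1 hn1' hd
  rw [← hE] at hbin
  rw [← hγdef] at hupper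
  set G := Finset.univ.filter fun q : (Fin n → Bool) × (Fin n → Bool) =>
    SecretKey.IsHammingPair U e D d n q.1 q.2 with hG
  have hlower : 0.99 * (2 ^ m) ^ 2 * (G.card : ℝ) ≤ (Ω.card : ℝ) := hlower
  have hgood' : (2 : ℝ) ^ n * n.choose d ≤ 2 * G.card := by exact_mod_cast hgood
  have hw := SecretKey.noiseWeight_pos hθ0 (by linarith) n d
  have hT : ((SecretKey.shortStrings (ℓ + 1)).card : ℝ) ≤ 2 ^ (ℓ + 1) := by
    exact_mod_cast SecretKey.card_shortStrings_le (ℓ + 1)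
  have hA : ((Finset.range (8 * n) ×ˢ (Finset.range (8 * n) ×ˢ Finset.range (8 * n))).card : ℝ) =
      (8 * n) ^ 3 := by
    simp only [Finset.card_product, Finset.card_range]
    push_cast
    ring
  rw [hA] at hupper
  set τ : ℝ := ((1 / 2 : ℝ) ^ s) ^ γ with hτ
  have hτ0 : 0 < τ := by positivity
  -- The constant `0.495` is `0.99 / 2`: agreement with probability above `0.99` on at least half of
  -- the pairs at distance `d`.
  have hmain : 0.495 * Real.exp (-E) ≤ (n + 1) * ((8 * n) ^ 3 * 2 ^ (ℓ + 1) * τ) := by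
    have h1 : (2 ^ n * (2 ^ m) ^ 2 : ℝ) *
        (0.495 * (n.choose d * SecretKey.noiseWeight θ n d)) ≤
        (2 ^ n * (2 ^ m) ^ 2) * ((8 * n) ^ 3 * 2 ^ (ℓ + 1) * τ) := by
      calc (2 ^ n * (2 ^ m) ^ 2 : ℝ) * (0.495 * (n.choose d * SecretKey.noiseWeight θ n d))
          = SecretKey.noiseWeight θ n d *
            (0.99 * (2 ^ m) ^ 2 * ((2 ^ n * n.choose d) / 2)) := by ring
        _ ≤ SecretKey.noiseWeight θ n d * (0.99 * (2 ^ m) ^ 2 * G.card) := by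
            gcongr
            linarith
        _ ≤ SecretKey.noiseWeight θ n d * Ω.card := by gcongr
        _ ≤ _ := hupper
        _ ≤ (8 * n) ^ 3 * 2 ^ (ℓ + 1) * (2 ^ n * (2 ^ m) ^ 2 * τ) := by gcongr
        _ = _ := by ring
    have h2 := le_of_mul_le_mul_left h1 (by positivity)
    calc 0.495 * Real.exp (-E)
        ≤ 0.495 * ((n + 1) * (n.choose d * SecretKey.noiseWeight θ n d)) := by gcongr
      _ = (n + 1) * (0.495 * (n.choose d * SecretKey.noiseWeight θ n d)) := by ring
      _ ≤ _ := by gcongr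
  have hlogs := Real.log_le_log (by positivity) hmain
  rw [Real.log_mul (by norm_num) (Real.exp_pos _).ne', Real.log_exp,
    Real.log_mul (by positivity) (by positivity), Real.log_mul (by positivity) hτ0.ne',
    Real.log_mul (by positivity) (by positivity), Real.log_pow, Real.log_pow,
    Real.log_mul (by norm_num) (by positivity), hτ, Real.log_rpow (by positivity), Real.log_pow,
    one_div, Real.log_inv] at hlogs
  have hc : -1 ≤ Real.log (0.495 : ℝ) := by
    rw [Real.le_log_iff_exp_le (by norm_num), Real.exp_neg]
    rw [inv_le_comm₀ (Real.exp_pos _) (by norm_num)]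
    have := Real.exp_one_gt_d9
    norm_num
    linarith
  have hsucc := SecretKey.log_succ_le hn1'
  have hfin := hN₃ n hn3
  have hγl : 0 < γ * Real.log 2 := by positivity
  -- From `l ≤ 2 log n + 1`: the term `32 (l + 3)` is at most `64 log n + 128`, and the margin and
  -- the floor lose one each.
  have hslow : δ * n - (|K| + 64) * Real.log n - (130 + c₀) ≤ s := by
    rw [hX] at hXs
    linarith
  have hs2 := mul_le_mul_of_nonneg_left hslow hγl.le
  have hℓ2 := mul_le_mul_of_nonneg_right hcomm.le hl2.le
  push_cast at hlogs
  linarith
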